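/- Let $\Omega\subset\mathbb{R}^2$ be a bounded open set and let $\lambda,D>0$ be constants such that $\lambda\mu\neq 1$ for every Dirichlet eigenvalue $\mu$ of $-\Delta$ on $\Omega$. Consider the linear stationary Cahn–Hilliard problem $D\Delta(-u-\lambda\Delta u)=f$ in $\Omega$, $u=-u-\lambda\Delta u=0$ on $\partial\Omega$, with $f\in L^2(\Omega)$, as the first-order system $$\nabla u-r=0,\qquad -u-\lambda\nabla\cdot r-q=0,\qquad \nabla q-t=0,\qquad -D\,\nabla\cdot t=-f,\qquad u=q=0\ \text{on }\partial\Omega .$$ Let $\mathcal P$ be a finite partition of $\Omega$: nonempty, pairwise disjoint open sets $K$ whose boundaries have measure zero, with $\Omega=\operatorname{int}\bigcup_K\overline K$; let $h_K$ be the diameter of $K$. Let $$U=H^1_0(\Omega)\times H^1_0(\Omega)\times H(\mathrm{div},\Omega)\times H(\mathrm{div},\Omega),\qquad V(\mathcal P)=H^1(\mathcal P)\times H^1(\mathcal P)\times L^2(\Omega)^2\times L^2(\Omega)^2,$$ where $H^1(\mathcal P)=\{v\in L^2(\Omega): v|_K\in H^1(K)\ \forall K\in\mathcal P\}$. For $\mathbf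 u=(u,q,r,t)\in U$ and $\mathbf v=(v,w,s,p)\in V(\mathcal P)$ put, with elementwise gradients of $v,w$, $$B(\mathbf u,\mathbf v)=\int_\Omega\big[(\nabla u-r)\cdot s+(\nabla q-t)\cdot p-(u+q)v+\lambda\, r\cdot\nabla v+D\,t\cdot\nabla w\big]dx-\sum_{K}\big(D\langle t\cdot n,w\rangle_{\partial K}+\lambda\langle r\cdot n,v\rangle_{\partial K}\big),\qquad F(\mathbf v)=-\int_\Omega f\,w\,dx,$$ where $\langle\cdot,\cdot\rangle_{\partial K}$ is the duality between the normal trace of an $H(\mathrm{div},K)$ field and the trace of an $H^1(K)$ function (an element of $H^1(K)/H^1_0(K)\cong H^{1/2}(\partial K)$), i.e. $\langle r\cdot n,v\rangle_{\partial K}=\int_K(r\cdot\nabla v+(\nabla\cdot r)v)\,dx$. Define the trial norms $$\|\mathbf u\|_{U(\Omega)}^2=\|u\|_{H^1}^2+\|q\|_{H^1}^2+\|r\|_{L^2}^2+\|t\|_{L^2}^2,\qquad \|\mathbf u\|_{U}^2=\|(r,t)\|_{\hat U}^2+\|\mathbf u\|_{U(\Omega)}^2,\qquad \|\mathbf u\|_{\mathrm{gr}}^2=\|u\|_{H^1}^2+\|q\|_{H^1}^2+\|r\|_{H(\mathrm{div})}^2+\|t\|_{H(\mathrm{div})}^2,$$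 where $\|(r,t)\|_{\hat U}=\inf\,(\|R\|_{H(\mathrm{div})}^2+\|T\|_{H(\mathrm{div})}^2)^{1/2}$ over all $R,T\in H(\mathrm{div},\Omega)$ having the same normal traces as $r,t$ on every $\partial K$ (minimum energy extension norm), and the test norms $$\|\mathbf v\|_{c}^2=\sum_K\int_K\big[c_K^2|\nabla v|^2+v^2+c_K^2|\nabla w|^2+w^2+|s|^2+|p|^2\big]dx,$$ written $\|\cdot\|_{V(\mathcal P)}$ for $c_K=h_K$, $\|\cdot\|_{V,1}$ for $c_K=1$ and $\|\cdot\|_{V}$ for $c_K=0$. Then the weak formulation "find $\mathbf u\in U$ with $B(\mathbf u,\mathbf v)=F(\mathbf v)$ for all $\mathbf v\in V(\mathcal P)$" is well posed, uniformly in the mesh. That is, there are constants $C,M>0$, depending only on $\Omega,\lambda,D$, such that for every partition $\mathcal P$: 1. (continuity) $|B(\mathbf u,\mathbf v)|\le M\|\mathbf u\|_U\|\mathbf v\|_{V,1}$, $|B(\mathbf u,\mathbf v)|\le M\|\mathbf u\|_{\mathrm{gr}}\|\mathbf v\|_{V}$ and $|F(\mathbf v)|\le\|f\|_{L^2}\|\mathbf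 v\|_{V}$ for all $\mathbf u\in U$, $\mathbf v\in V(\mathcal P)$, $f\in L^2(\Omega)$; 2. (inf-sup) for all $\mathbf u\in U$, $$C\|\mathbf u\|_U\le\sup_{\mathbf v\ne0}\frac{|B(\mathbf u,\mathbf v)|}{\|\mathbf v\|_{V(\mathcal P)}},\qquad C\|\mathbf u\|_U\le\sup_{\mathbf v\ne0}\frac{|B(\mathbf u,\mathbf v)|}{\|\mathbf v\|_{V,1}},\qquad C\|\mathbf u\|_{\mathrm{gr}}\le\sup_{\mathbf v\ne0}\frac{|B(\mathbf u,\mathbf v)|}{\|\mathbf v\|_{V}};$$ 3. if $\mathbf v\in V(\mathcal P)$ and $B(\mathbf u,\mathbf v)=0$ for all $\mathbf u\in U$, then $\mathbf v=0$; 4. for every $f\in L^2(\Omega)$ there is exactly one solution $\mathbf u\in U$, and it satisfies $C\|\mathbf u\|_U\le\|f\|_{L^2}$ and $C\|\mathbf u\|_{\mathrm{gr}}\le\|f\|_{L^2}$. -/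

import Mathlib

open MeasureTheory TopologicalSpace
open scoped Distributions Gradient ENNReal

noncomputable section

namespace CahnHilliard

/-- The plane `ℝ²` with its Euclidean structure. -/
abbrev Plane : Type := EuclideanSpace ℝ (Fin 2)

/-- `L²(K; F)`. -/
abbrev L2 (K : Opens Plane) (F : Type) [NormedAddCommGroup F] : Type :=
  Lp F 2 (volume.restrict (K : Set Plane))

/-- `g` is the weak gradient of `u` in the open set `K`. -/
def HasWeakGrad (K : Opens Plane) (u : Plane → ℝ) (g : Plane → Plane) : Prop :=
  ∀ φ : 𝓓(K, ℝ), ∫ x in (K : Set Plane), u x • ∇ φ x = -∫ x in (K : Set Plane), φ x • g x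

/-- `d` is the weak divergence of `r` in the open set `K`. -/
def HasWeakDiv (K : Opens Plane) (r : Plane → Plane) (d : Plane → ℝ) : Prop :=
  ∀ φ : 𝓓(K, ℝ),
    ∫ x in (K : Set Plane), inner ℝ (r x) (∇ φ x) = -∫ x in (K : Set Plane), φ x * d x

section Integrability

variable {K L : Opens Plane}

lemma continuous_gradient (φ : 𝓓(K, ℝ)) : Continuous (fun x => ∇ φ x) := by
  have h : Continuous (fderiv ℝ (φ : Plane → ℝ)) :=
    φ.contDiff.continuous_fderiv (by simp)
  exact (InnerProductSpace.toDual ℝ Plane).symm.continuous.comp h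

lemma gradient_eq_zero (φ : 𝓓(K, ℝ)) {x : Plane} (hx : x ∉ tsupport φ) : ∇ φ x = 0 := by
  have : fderiv ℝ (φ : Plane → ℝ) x = 0 := by
    by_contra h
    exact hx (support_fderiv_subset ℝ h)
  simp [gradient, this]

lemma memLp_gradient (φ : 𝓓(K, ℝ)) (μ : Measure Plane) [IsFiniteMeasureOnCompacts μ] :
    MemLp (fun x => ∇ φ x) 2 μ :=
  (continuous_gradient φ).memLp_of_hasCompactSupport
    (HasCompactSupport.intro φ.hasCompactSupport fun _ hx => gradient_eq_zero φ hx)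

lemma memLp_testFunction (φ : 𝓓(K, ℝ)) (μ : Measure Plane) [IsFiniteMeasureOnCompacts μ] :
    MemLp (φ : Plane → ℝ) 2 μ :=
  φ.continuous.memLp_of_hasCompactSupport φ.hasCompactSupport

lemma integrable_smul_gradient (φ : 𝓓(K, ℝ)) (u : L2 L ℝ) :
    Integrable (fun x => u x • ∇ φ x) (volume.restrict (L : Set Plane)) :=
  memLp_one_iff_integrable.mp ((memLp_gradient φ _).smul (Lp.memLp u))

lemma integrable_smul_field (φ : 𝓓(K, ℝ)) (g : L2 L Plane) :
    Integrable (fun x => φ x • g x) (volume.restrict (L : Set Plane)) :=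
  memLp_one_iff_integrable.mp ((Lp.memLp g).smul (memLp_testFunction φ _))

lemma integrable_inner_gradient (φ : 𝓓(K, ℝ)) (r : L2 L Plane) :
    Integrable (fun x => inner ℝ (r x) (∇ φ x)) (volume.restrict (L : Set Plane)) :=
  memLp_one_iff_integrable.mp <| MemLp.of_bilin (fun a b : Plane => inner ℝ a b) 1
    (Lp.memLp r) (memLp_gradient φ _)
    ((Lp.memLp r).aestronglyMeasurable.inner (memLp_gradient φ _).aestronglyMeasurable)
    (Filter.Eventually.of_forall fun x => by
      rw [one_mul]
      exact nnnorm_inner_le_nnnorm (𝕜 := ℝ) (r x) (∇ φ x))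

lemma integrable_mul_scalar (φ : 𝓓(K, ℝ)) (d : L2 L ℝ) :
    Integrable (fun x => φ x * d x) (volume.restrict (L : Set Plane)) :=
  (memLp_testFunction φ _).integrable_mul (Lp.memLp d)

end Integrability

/-- `H¹(K)`: the pairs `(u, ∇u)` in `L²(K) × L²(K)²`, the second component being the weak
gradient of the first (hence determined by it). The norm inherited from the `ℓ²`-product is
the usual norm `(‖u‖² + ‖∇u‖²)^{1/2}`. -/
def H1 (K : Opens Plane) : Submodule ℝ (WithLp 2 (L2 K ℝ × L2 K Plane)) where
  carrier := {p | HasWeakGrad K p.fst p.snd}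
  zero_mem' := by
    intro φ
    have h1 : ∫ x in (K : Set Plane), (0 : L2 K ℝ) x • ∇ φ x = 0 := by
      refine integral_eq_zero_of_ae ?_
      filter_upwards [Lp.coeFn_zero ℝ 2 (volume.restrict (K : Set Plane))] with x hx
      rw [hx]
      simp
    have h2 : ∫ x in (K : Set Plane), φ x • (0 : L2 K Plane) x = 0 := by
      refine integral_eq_zero_of_ae ?_
      filter_upwards [Lp.coeFn_zero Plane 2 (volume.restrict (K : Set Plane))] with x hx
      rw [hx]
      simp
    rw [WithLp.zero_fst, WithLp.zero_snd, h1, h2, neg_zero]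
  add_mem' := by
    intro p q hp hq φ
    have h1 : ∫ x in (K : Set Plane), (p.fst + q.fst) x • ∇ φ x =
        ∫ x in (K : Set Plane), (p.fst x • ∇ φ x + q.fst x • ∇ φ x) := by
      refine integral_congr_ae ?_
      filter_upwards [Lp.coeFn_add p.fst q.fst] with x hx
      rw [hx, Pi.add_apply, add_smul]
    have h2 : ∫ x in (K : Set Plane), φ x • (p.snd + q.snd) x =
        ∫ x in (K : Set Plane), (φ x • p.snd x + φ x • q.snd x) := by
      refine integral_congr_ae ?_
      filter_upwards [Lp.coeFn_add p.snd q.snd] with x hx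
      rw [hx, Pi.add_apply, smul_add]
    rw [WithLp.add_fst, WithLp.add_snd, h1, h2,
      integral_add (integrable_smul_gradient φ _) (integrable_smul_gradient φ _),
      integral_add (integrable_smul_field φ _) (integrable_smul_field φ _), hp φ, hq φ, neg_add]
  smul_mem' := by
    intro c p hp φ
    have h1 : ∫ x in (K : Set Plane), (c • p.fst) x • ∇ φ x =
        ∫ x in (K : Set Plane), c • (p.fst x • ∇ φ x) := by
      refine integral_congr_ae ?_
      filter_upwards [Lp.coeFn_smul c p.fst] with x hx
      rw [hx, Pi.smul_apply, smul_assoc]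
    have h2 : ∫ x in (K : Set Plane), φ x • (c • p.snd) x =
        ∫ x in (K : Set Plane), c • (φ x • p.snd x) := by
      refine integral_congr_ae ?_
      filter_upwards [Lp.coeFn_smul c p.snd] with x hx
      rw [hx, Pi.smul_apply, smul_comm]
    rw [WithLp.smul_fst, WithLp.smul_snd, h1, h2, integral_smul, integral_smul, hp φ, smul_neg]

/-- `H(div, K)`: the pairs `(r, div r)` in `L²(K)² × L²(K)`, with the norm
`(‖r‖² + ‖div r‖²)^{1/2}`. -/
def Hdiv (K : Opens Plane) : Submodule ℝ (WithLp 2 (L2 K Plane × L2 K ℝ)) where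
  carrier := {p | HasWeakDiv K p.fst p.snd}
  zero_mem' := by
    intro φ
    have h1 : ∫ x in (K : Set Plane), inner ℝ ((0 : L2 K Plane) x) (∇ φ x) = 0 := by
      refine integral_eq_zero_of_ae ?_
      filter_upwards [Lp.coeFn_zero Plane 2 (volume.restrict (K : Set Plane))] with x hx
      rw [hx]
      simp
    have h2 : ∫ x in (K : Set Plane), φ x * (0 : L2 K ℝ) x = 0 := by
      refine integral_eq_zero_of_ae ?_
      filter_upwards [Lp.coeFn_zero ℝ 2 (volume.restrict (K : Set Plane))] with x hx
      rw [hx]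
      simp
    rw [WithLp.zero_fst, WithLp.zero_snd, h1, h2, neg_zero]
  add_mem' := by
    intro p q hp hq φ
    have h1 : ∫ x in (K : Set Plane), inner ℝ ((p.fst + q.fst) x) (∇ φ x) =
        ∫ x in (K : Set Plane), (inner ℝ (p.fst x) (∇ φ x) + inner ℝ (q.fst x) (∇ φ x)) := by
      refine integral_congr_ae ?_
      filter_upwards [Lp.coeFn_add p.fst q.fst] with x hx
      rw [hx, Pi.add_apply, inner_add_left]
    have h2 : ∫ x in (K : Set Plane), φ x * (p.snd + q.snd) x =
        ∫ x in (K : Set Plane), (φ x * p.snd x + φ x * q.snd x) := by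
      refine integral_congr_ae ?_
      filter_upwards [Lp.coeFn_add p.snd q.snd] with x hx
      rw [hx, Pi.add_apply, mul_add]
    rw [WithLp.add_fst, WithLp.add_snd, h1, h2,
      integral_add (integrable_inner_gradient φ _) (integrable_inner_gradient φ _),
      integral_add (integrable_mul_scalar φ _) (integrable_mul_scalar φ _), hp φ, hq φ, neg_add]
  smul_mem' := by
    intro c p hp φ
    have h1 : ∫ x in (K : Set Plane), inner ℝ ((c • p.fst) x) (∇ φ x) =
        ∫ x in (K : Set Plane), c • inner ℝ (p.fst x) (∇ φ x) := by
      refine integral_congr_ae ?_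
      filter_upwards [Lp.coeFn_smul c p.fst] with x hx
      rw [hx, Pi.smul_apply, real_inner_smul_left, smul_eq_mul]
    have h2 : ∫ x in (K : Set Plane), φ x * (c • p.snd) x =
        ∫ x in (K : Set Plane), c • (φ x * p.snd x) := by
      refine integral_congr_ae ?_
      filter_upwards [Lp.coeFn_smul c p.snd] with x hx
      rw [hx, Pi.smul_apply, smul_eq_mul, smul_eq_mul]
      ring
    rw [WithLp.smul_fst, WithLp.smul_snd, h1, h2, integral_smul, integral_smul, hp φ, smul_neg]

/-- The smooth compactly supported functions on `K`, as a subspace of `H¹(K)`. -/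
def smoothH1 (K : Opens Plane) : Submodule ℝ (H1 K) :=
  Submodule.span ℝ
    {p | ∃ φ : 𝓓(K, ℝ),
      (p : WithLp 2 (L2 K ℝ × L2 K Plane)).fst =ᵐ[volume.restrict (K : Set Plane)] φ ∧
      (p : WithLp 2 (L2 K ℝ × L2 K Plane)).snd =ᵐ[volume.restrict (K : Set Plane)]
        fun x => ∇ φ x}

/-- `H¹₀(K)`: the closure of the smooth compactly supported functions in `H¹(K)`. -/
def H10 (K : Opens Plane) : Submodule ℝ (H1 K) := (smoothH1 K).topologicalClosure

/-- Values of an `H¹` function. -/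
abbrev H1.val {K : Opens Plane} (u : H1 K) : L2 K ℝ := u.1.fst

/-- Weak gradient of an `H¹` function. -/
abbrev H1.grad {K : Opens Plane} (u : H1 K) : L2 K Plane := u.1.snd

/-- Values of an `H(div)` field. -/
abbrev Hdiv.val {K : Opens Plane} (r : Hdiv K) : L2 K Plane := r.1.fst

/-- Weak divergence of an `H(div)` field. -/
abbrev Hdiv.div {K : Opens Plane} (r : Hdiv K) : L2 K ℝ := r.1.snd

/-- `μ` is a Dirichlet eigenvalue of `-Δ` in `Ω`. -/
def IsDirichletEigenvalue (Ω : Opens Plane) (μ : ℝ) : Prop :=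
  ∃ u : H1 Ω, u ∈ H10 Ω ∧ u ≠ 0 ∧
    ∀ v : H1 Ω, v ∈ H10 Ω → inner ℝ (H1.grad u) (H1.grad v) = μ * inner ℝ (H1.val u) (H1.val v)

section Restriction

variable {K Ω : Opens Plane} {F : Type} [NormedAddCommGroup F]

lemma memLp_restrict (h : K ≤ Ω) (u : L2 Ω F) :
    MemLp u 2 (volume.restrict (K : Set Plane)) :=
  (Lp.memLp u).mono_measure (Measure.restrict_mono h le_rfl)

variable [NormedSpace ℝ F]

/-- Restriction `L²(Ω; F) → L²(K; F)` to a smaller open set. -/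
def restrictL2 (h : K ≤ Ω) : L2 Ω F →ₗ[ℝ] L2 K F where
  toFun u := (memLp_restrict h u).toLp u
  map_add' u v := by
    rw [← MemLp.toLp_add, MemLp.toLp_eq_toLp_iff]
    exact ae_mono (Measure.restrict_mono h le_rfl) (Lp.coeFn_add u v)
  map_smul' c u := by
    rw [RingHom.id_apply, ← MemLp.toLp_const_smul, MemLp.toLp_eq_toLp_iff]
    exact ae_mono (Measure.restrict_mono h le_rfl) (Lp.coeFn_smul c u)

lemma coeFn_restrictL2 (h : K ≤ Ω) (u : L2 Ω F) :
    (restrictL2 h u : Plane → F) =ᵐ[volume.restrict (K : Set Plane)] u :=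
  MemLp.coeFn_toLp (memLp_restrict h u)

/-- Restriction of a pair of square integrable functions. -/
def restrictPair {G : Type} [NormedAddCommGroup G] [NormedSpace ℝ G] (h : K ≤ Ω) :
    WithLp 2 (L2 Ω F × L2 Ω G) →ₗ[ℝ] WithLp 2 (L2 K F × L2 K G) where
  toFun p := WithLp.toLp 2 (restrictL2 h p.fst, restrictL2 h p.snd)
  map_add' p q := by simp [← WithLp.toLp_add]
  map_smul' c p := by simp [← WithLp.toLp_smul]

lemma restrictPair_mem_Hdiv (h : K ≤ Ω) (r : Hdiv Ω) : restrictPair h r.1 ∈ Hdiv K := by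
  intro φ
  let ψ : 𝓓(Ω, ℝ) := ⟨φ, φ.contDiff, φ.hasCompactSupport, φ.tsupport_subset.trans h⟩
  have hψ : ∀ x, ψ x = φ x := fun _ => rfl
  have hgrad : ∀ x, ∇ ψ x = ∇ φ x := fun _ => rfl
  have hr := r.2 ψ
  have h1 : ∫ x in (K : Set Plane), inner ℝ ((restrictPair h r.1).fst x) (∇ φ x) =
      ∫ x in (Ω : Set Plane), inner ℝ (r.1.fst x) (∇ ψ x) := by
    rw [setIntegral_eq_of_subset_of_forall_sdiff_eq_zero (s := (K : Set Plane))
      Ω.isOpen.measurableSet h]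
    · refine integral_congr_ae ?_
      filter_upwards [coeFn_restrictL2 h r.1.fst] with x hx
      rw [hgrad]
      exact congrArg (fun y => inner ℝ y (∇ φ x)) hx
    · intro x hx
      rw [hgrad, gradient_eq_zero φ (fun hx' => hx.2 (φ.tsupport_subset hx')), inner_zero_right]
  have h2 : ∫ x in (K : Set Plane), φ x * (restrictPair h r.1).snd x =
      ∫ x in (Ω : Set Plane), ψ x * r.1.snd x := by
    rw [setIntegral_eq_of_subset_of_forall_sdiff_eq_zero (s := (K : Set Plane))
      Ω.isOpen.measurableSet h]
    · refine integral_congr_ae ?_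
      filter_upwards [coeFn_restrictL2 h r.1.snd] with x hx
      rw [hψ]
      exact congrArg (fun y => φ x * y) hx
    · intro x hx
      have : φ x = 0 := by
        by_contra h0
        exact hx.2 (φ.tsupport_subset (subset_tsupport _ h0))
      rw [hψ, this, zero_mul]
  rw [h1, h2, hr]

/-- Restriction `H(div, Ω) → H(div, K)`. -/
def Hdiv.restrict (h : K ≤ Ω) (r : Hdiv Ω) : Hdiv K :=
  ⟨restrictPair h r.1, restrictPair_mem_Hdiv h r⟩

end Restriction

section Traces

variable {K : Opens Plane}

/-- The bilinear form `(r, v) ↦ ∫_K (r · ∇v + (div r) v)` of Green's formula. -/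
def green (r : Hdiv K) : H1 K →ₗ[ℝ] ℝ where
  toFun v := inner ℝ (Hdiv.val r) (H1.grad v) + inner ℝ (Hdiv.div r) (H1.val v)
  map_add' v w := by
    have h1 : H1.grad (v + w) = H1.grad v + H1.grad w := rfl
    have h2 : H1.val (v + w) = H1.val v + H1.val w := rfl
    rw [h1, h2, inner_add_right, inner_add_right]
    ring
  map_smul' c v := by
    have h1 : H1.grad (c • v) = c • H1.grad v := rfl
    have h2 : H1.val (c • v) = c • H1.val v := rfl
    rw [h1, h2, real_inner_smul_right, real_inner_smul_right, RingHom.id_apply, smul_eq_mul]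
    ring

lemma continuous_green (r : Hdiv K) : Continuous (green r) := by
  have h1 : Continuous fun v : H1 K => H1.val v :=
    (WithLp.prod_continuous_ofLp 2 _ _).fst.comp continuous_subtype_val
  have h2 : Continuous fun v : H1 K => H1.grad v :=
    (WithLp.prod_continuous_ofLp 2 _ _).snd.comp continuous_subtype_val
  exact (continuous_const.inner h2).add (continuous_const.inner h1)

/-- Green's form depends on `v` only through its class modulo `H¹₀(K)`. -/
lemma green_eq_zero_of_mem_H10 (r : Hdiv K) : H10 K ≤ LinearMap.ker (green r) := by
  refine Submodule.topologicalClosure_minimal _ (Submodule.span_le.2 ?_)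
    (isClosed_singleton.preimage (continuous_green r))
  rintro v ⟨φ, h1, h2⟩
  have hr := r.2 φ
  have e1 : inner ℝ (Hdiv.val r) (H1.grad v) =
      ∫ x in (K : Set Plane), inner ℝ (r.1.fst x) (∇ φ x) := by
    rw [L2.inner_def]
    refine integral_congr_ae ?_
    filter_upwards [h2] with x hx
    exact congrArg (fun y => inner ℝ (r.1.fst x) y) hx
  have e2 : inner ℝ (Hdiv.div r) (H1.val v) =
      ∫ x in (K : Set Plane), φ x * r.1.snd x := by
    rw [L2.inner_def]
    refine integral_congr_ae ?_
    filter_upwards [h1] with x hx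
    have : inner ℝ (r.1.snd x) (v.1.fst x) = v.1.fst x * r.1.snd x := by simp
    exact this.trans (by rw [hx])
  show inner ℝ (Hdiv.val r) (H1.grad v) + inner ℝ (Hdiv.div r) (H1.val v) = 0
  rw [e1, e2, hr, neg_add_cancel]

/-- The trace space `H^{1/2}(∂K)`, realised as `H¹(K) / H¹₀(K)`. For a Lipschitz set `K` the
usual boundary trace induces an isomorphism from this quotient onto `H^{1/2}(∂K)`. -/
abbrev TraceSpace (K : Opens Plane) : Type := H1 K ⧸ H10 K

/-- The trace operator `γ₀ : H¹(K) → H^{1/2}(∂K)`. -/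
def trace : H1 K →ₗ[ℝ] TraceSpace K := (H10 K).mkQ

/-- The normal trace operator `γ_n`, with values in linear functionals on `H^{1/2}(∂K)`;
`normalTrace r (trace v)` is the duality pairing usually written `∮_{∂K} (r · n) v ds`. -/
def normalTrace (r : Hdiv K) : TraceSpace K →ₗ[ℝ] ℝ :=
  (H10 K).liftQ (green r) (green_eq_zero_of_mem_H10 r)

end Traces

/-- A partition of `Ω` into finitely many open elements. -/
structure Partition (Ω : Opens Plane) (n : ℕ) where
  elem : Fin n → Opens Plane
  nonempty : ∀ m, (elem m : Set Plane).Nonempty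
  disjoint : Pairwise fun m k => Disjoint (elem m : Set Plane) (elem k : Set Plane)
  null_frontier : ∀ m, volume (frontier (elem m : Set Plane)) = 0
  eq_interior : (Ω : Set Plane) = interior (⋃ m, closure (elem m : Set Plane))

lemma Partition.le {Ω : Opens Plane} {n : ℕ} (P : Partition Ω n) (m : Fin n) :
    P.elem m ≤ Ω := by
  intro x hx
  show x ∈ (Ω : Set Plane)
  rw [P.eq_interior]
  exact interior_maximal
    (subset_closure.trans (Set.subset_iUnion (fun m => closure (P.elem m : Set Plane)) m))
    (P.elem m).isOpen hx

section Broken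

variable {Ω : Opens Plane} {n : ℕ}

/-- The broken space `H¹(P)`: the functions `v ∈ L²(Ω)` with `v|_K ∈ H¹(K)` for each element
`K`, together with their elementwise gradient (determined almost everywhere by `v`). -/
def BrokenH1 (P : Partition Ω n) : Submodule ℝ (WithLp 2 (L2 Ω ℝ × L2 Ω Plane)) where
  carrier := {p | ∀ m, restrictPair (P.le m) p ∈ H1 (P.elem m)}
  zero_mem' m := by
    rw [map_zero]
    exact (H1 (P.elem m)).zero_mem
  add_mem' hp hq m := by
    rw [map_add]
    exact (H1 (P.elem m)).add_mem (hp m) (hq m)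
  smul_mem' c p hp m := by
    rw [map_smul]
    exact (H1 (P.elem m)).smul_mem c (hp m)

/-- Values of a broken `H¹` function. -/
abbrev BrokenH1.val {P : Partition Ω n} (v : BrokenH1 P) : L2 Ω ℝ := v.1.fst

/-- Elementwise gradient of a broken `H¹` function. -/
abbrev BrokenH1.grad {P : Partition Ω n} (v : BrokenH1 P) : L2 Ω Plane := v.1.snd

/-- Restriction of a broken `H¹` function to an element. -/
def BrokenH1.restrict {P : Partition Ω n} (v : BrokenH1 P) (m : Fin n) : H1 (P.elem m) :=
  ⟨restrictPair (P.le m) v.1, v.2 m⟩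

end Broken

/-- The trial space `H¹₀(Ω) × H¹₀(Ω) × H(div, Ω) × H(div, Ω)`. -/
@[ext]
structure Trial (Ω : Opens Plane) where
  u : H10 Ω
  q : H10 Ω
  r : Hdiv Ω
  t : Hdiv Ω

/-- The broken test space `H¹(P) × H¹(P) × L²(Ω)² × L²(Ω)²`. -/
@[ext]
structure Test {Ω : Opens Plane} {n : ℕ} (P : Partition Ω n) where
  v : BrokenH1 P
  w : BrokenH1 P
  s : L2 Ω Plane
  p : L2 Ω Plane

section Forms

variable {Ω : Opens Plane} {n : ℕ}

/-- The volume part of the weak form,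
`∫_Ω (∇u - r)·s + (∇q - t)·p - (u + q) v + lam r·∇v + D t·∇w`, where the gradients of `v` and
`w` are taken elementwise. -/
def formVolume (P : Partition Ω n) (lam D : ℝ) (U : Trial Ω) (V : Test P) : ℝ :=
  inner ℝ (H1.grad U.u.1 - Hdiv.val U.r) V.s + inner ℝ (H1.grad U.q.1 - Hdiv.val U.t) V.p
    - inner ℝ (H1.val U.u.1 + H1.val U.q.1) (BrokenH1.val V.v)
    + lam * inner ℝ (Hdiv.val U.r) (BrokenH1.grad V.v)
    + D * inner ℝ (Hdiv.val U.t) (BrokenH1.grad V.w)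

/-- The skeleton part: the sum over the elements of
`∮_{∂K} (D γ_n(t) γ₀(w) + lam γ_n(r) γ₀(v)) ds`. -/
def formSkeleton (P : Partition Ω n) (lam D : ℝ) (U : Trial Ω) (V : Test P) : ℝ :=
  ∑ m, (D * normalTrace (Hdiv.restrict (P.le m) U.t) (trace (BrokenH1.restrict V.w m))
    + lam * normalTrace (Hdiv.restrict (P.le m) U.r) (trace (BrokenH1.restrict V.v m)))

/-- The broken weak form, obtained by testing the first-order system
`∇u - r = 0`, `∇q - t = 0`, `-u - lam div r - q = 0`, `-D div t = -f` on each element and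
integrating the divergence terms by parts. -/
def form (P : Partition Ω n) (lam D : ℝ) (U : Trial Ω) (V : Test P) : ℝ :=
  formVolume P lam D U V - formSkeleton P lam D U V

/-- The load `V ↦ -∫_Ω f w`. -/
def load (P : Partition Ω n) (f : L2 Ω ℝ) (V : Test P) : ℝ :=
  -inner ℝ f (BrokenH1.val V.w)

/-- The norm of `H¹ × H¹ × L² × L²` on the trial space. -/
def normField (U : Trial Ω) : ℝ :=
  Real.sqrt (‖U.u‖ ^ 2 + ‖U.q‖ ^ 2 + ‖Hdiv.val U.r‖ ^ 2 + ‖Hdiv.val U.t‖ ^ 2)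

/-- The norm of `H¹ × H¹ × H(div) × H(div)` on the trial space. -/
def normGraph (U : Trial Ω) : ℝ :=
  Real.sqrt (‖U.u‖ ^ 2 + ‖U.q‖ ^ 2 + ‖U.r‖ ^ 2 + ‖U.t‖ ^ 2)

/-- The minimum energy extension norm of the normal traces of `(r, t)` on the skeleton: the
infimum of `(‖R‖² + ‖T‖²)^{1/2}` (norms in `H(div, Ω)`) over all `R, T ∈ H(div, Ω)` having the
same normal traces as `r, t` on the boundary of each element. -/
def normSkeleton (P : Partition Ω n) (r t : Hdiv Ω) : ℝ :=
  sInf {x : ℝ | ∃ R T : Hdiv Ω,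
    (∀ m, normalTrace (Hdiv.restrict (P.le m) R) = normalTrace (Hdiv.restrict (P.le m) r) ∧
      normalTrace (Hdiv.restrict (P.le m) T) = normalTrace (Hdiv.restrict (P.le m) t)) ∧
    x = Real.sqrt (‖R‖ ^ 2 + ‖T‖ ^ 2)}

/-- The trial norm of the broken formulation, the square root of
`‖(r, t)‖²` (minimum energy extension norm) `+ ‖(u, q, r, t)‖²` (norm `normField`). -/
def normTrial (P : Partition Ω n) (U : Trial Ω) : ℝ :=
  Real.sqrt (normSkeleton P U.r U.t ^ 2 + normField U ^ 2)

/-- The weighted norm on the test space with square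
`∑_K ∫_K (c_K² |∇v|² + v² + c_K² |∇w|² + w² + |s|² + |p|²)`. -/
def normTestWeighted (P : Partition Ω n) (c : Fin n → ℝ) (V : Test P) : ℝ :=
  Real.sqrt (∑ m,
    (c m ^ 2 * ‖H1.grad (BrokenH1.restrict V.v m)‖ ^ 2 + ‖H1.val (BrokenH1.restrict V.v m)‖ ^ 2
      + c m ^ 2 * ‖H1.grad (BrokenH1.restrict V.w m)‖ ^ 2 + ‖H1.val (BrokenH1.restrict V.w m)‖ ^ 2
      + ‖restrictL2 (P.le m) V.s‖ ^ 2 + ‖restrictL2 (P.le m) V.p‖ ^ 2))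

/-- The mesh-weighted test norm: the gradients on `K` are weighted by the diameter of `K`. -/
def normTest (P : Partition Ω n) (V : Test P) : ℝ :=
  normTestWeighted P (fun m => Metric.diam (P.elem m : Set Plane)) V

/-- The unweighted broken `H¹ × H¹ × L² × L²` norm on the test space. -/
def normTestH1 (P : Partition Ω n) (V : Test P) : ℝ := normTestWeighted P (fun _ => 1) V

/-- The `L²` norm on the test space. -/
def normTestL2 (P : Partition Ω n) (V : Test P) : ℝ := normTestWeighted P (fun _ => 0) V

/-- The inf-sup condition `C ‖U‖ ≤ sup_V |B(U, V)| / ‖V‖` for all trial functions `U`; the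
supremum is taken in `[0, ∞]`, and `V = 0` contributes the value `0`. -/
def InfSup (P : Partition Ω n) (lam D C : ℝ) (normU : Trial Ω → ℝ) (normV : Test P → ℝ) : Prop :=
  ∀ U : Trial Ω,
    ENNReal.ofReal (C * normU U) ≤ ⨆ V : Test P, ENNReal.ofReal (|form P lam D U V| / normV V)

end Forms

end CahnHilliard

end

open MeasureTheory TopologicalSpace
open scoped Distributions Gradient ENNReal

noncomputable section

namespace CahnHilliard

section TestFunctions

variable {K Ω : Opens Plane}

lemma inner_gradient (φ : Plane → ℝ) (x e : Plane) : inner ℝ (∇ φ x) e = fderiv ℝ φ x e := by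
  simp [gradient]

/-- Extension of a test function to a larger open set. -/
def extendTest (h : K ≤ Ω) (φ : 𝓓(K, ℝ)) : 𝓓(Ω, ℝ) :=
  ⟨φ, φ.contDiff, φ.hasCompactSupport, φ.tsupport_subset.trans h⟩

lemma testFunction_eq_zero (φ : 𝓓(K, ℝ)) {x : Plane} (hx : x ∉ (K : Set Plane)) : φ x = 0 := by
  by_contra h0
  exact hx (φ.tsupport_subset (subset_tsupport _ h0))

lemma gradient_eq_zero_of_notMem (φ : 𝓓(K, ℝ)) {x : Plane} (hx : x ∉ (K : Set Plane)) :
    ∇ φ x = 0 :=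
  gradient_eq_zero φ fun h => hx (φ.tsupport_subset h)

lemma integrable_smul_gradient_test (φ : 𝓓(K, ℝ)) (ψ : 𝓓(Ω, ℝ)) :
    Integrable (fun x => φ x • ∇ ψ x) :=
  memLp_one_iff_integrable.mp ((memLp_gradient ψ volume).smul (memLp_testFunction φ volume))

lemma integral_smul_gradient (φ : 𝓓(K, ℝ)) (ψ : 𝓓(Ω, ℝ)) :
    ∫ x, φ x • ∇ ψ x = -∫ x, ψ x • ∇ φ x := by
  refine ext_inner_right ℝ fun e => ?_
  have i1 := integrable_smul_gradient_test φ ψ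
  have i2 := integrable_smul_gradient_test ψ φ
  have k1 : inner ℝ (∫ x, φ x • ∇ ψ x) e = ∫ x, inner ℝ e (φ x • ∇ ψ x) := by
    rw [real_inner_comm, integral_inner i1]
  have k2 : inner ℝ (-∫ x, ψ x • ∇ φ x) e = -∫ x, inner ℝ e (ψ x • ∇ φ x) := by
    rw [inner_neg_left, real_inner_comm, integral_inner i2]
  rw [k1, k2]
  have e1 : ∀ x, inner ℝ e (φ x • ∇ ψ x) = φ x * fderiv ℝ ψ x e := fun x => by
    rw [real_inner_comm, real_inner_smul_left, inner_gradient]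
  have e2 : ∀ x, inner ℝ e (ψ x • ∇ φ x) = fderiv ℝ φ x e * ψ x := fun x => by
    rw [real_inner_comm, real_inner_smul_left, inner_gradient, mul_comm]
  have j1 := i1.const_inner (𝕜 := ℝ) e
  have j2 := i2.const_inner (𝕜 := ℝ) e
  simp only [e1] at j1 ⊢
  simp only [e2] at j2 ⊢
  refine integral_mul_fderiv_eq_neg_fderiv_mul_of_integrable j2 j1 ?_ ?_ ?_
  · exact (memLp_testFunction φ volume).integrable_mul (memLp_testFunction ψ volume)
  · exact fun x _ => (φ.contDiff.differentiable (by simp)).differentiableAt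
  · exact fun x _ => (ψ.contDiff.differentiable (by simp)).differentiableAt

lemma hasWeakGrad_of_ae_eq {φ : 𝓓(Ω, ℝ)} {u : Plane → ℝ} {g : Plane → Plane}
    (hu : u =ᵐ[volume.restrict (Ω : Set Plane)] φ)
    (hg : g =ᵐ[volume.restrict (Ω : Set Plane)] fun x => ∇ φ x) : HasWeakGrad Ω u g := by
  intro ψ
  have e1 : ∫ x in (Ω : Set Plane), u x • ∇ ψ x = ∫ x in (Ω : Set Plane), φ x • ∇ ψ x := by
    refine integral_congr_ae ?_
    filter_upwards [hu] with x hx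
    rw [hx]
  have e2 : ∫ x in (Ω : Set Plane), ψ x • g x = ∫ x in (Ω : Set Plane), ψ x • ∇ φ x := by
    refine integral_congr_ae ?_
    filter_upwards [hg] with x hx
    rw [hx]
  rw [e1, e2, setIntegral_eq_integral_of_forall_compl_eq_zero
      fun x hx => by rw [testFunction_eq_zero φ hx, zero_smul],
    setIntegral_eq_integral_of_forall_compl_eq_zero
      fun x hx => by rw [testFunction_eq_zero ψ hx, zero_smul], integral_smul_gradient φ ψ]

/-- A test function as an element of `H¹`. -/
def testH1 (φ : 𝓓(Ω, ℝ)) : H1 Ω :=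
  ⟨WithLp.toLp 2 ((memLp_testFunction φ (volume.restrict (Ω : Set Plane))).toLp φ,
      (memLp_gradient φ (volume.restrict (Ω : Set Plane))).toLp (fun x => ∇ φ x)),
    hasWeakGrad_of_ae_eq
      (memLp_testFunction φ (volume.restrict (Ω : Set Plane))).coeFn_toLp
      (memLp_gradient φ (volume.restrict (Ω : Set Plane))).coeFn_toLp⟩

lemma coeFn_val_testH1 (φ : 𝓓(Ω, ℝ)) :
    H1.val (testH1 φ) =ᵐ[volume.restrict (Ω : Set Plane)] φ :=
  (memLp_testFunction φ (volume.restrict (Ω : Set Plane))).coeFn_toLp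

lemma coeFn_grad_testH1 (φ : 𝓓(Ω, ℝ)) :
    H1.grad (testH1 φ) =ᵐ[volume.restrict (Ω : Set Plane)] fun x => ∇ φ x :=
  (memLp_gradient φ (volume.restrict (Ω : Set Plane))).coeFn_toLp

lemma testH1_mem_H10 (φ : 𝓓(Ω, ℝ)) : testH1 φ ∈ H10 Ω :=
  (smoothH1 Ω).le_topologicalClosure <|
    Submodule.subset_span ⟨φ, coeFn_val_testH1 φ, coeFn_grad_testH1 φ⟩

lemma testH1_eq {p : H1 Ω} {φ : 𝓓(Ω, ℝ)}
    (h : (p : WithLp 2 (L2 Ω ℝ × L2 Ω Plane)).fst =ᵐ[volume.restrict (Ω : Set Plane)] φ)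
    (h' : (p : WithLp 2 (L2 Ω ℝ × L2 Ω Plane)).snd =ᵐ[volume.restrict (Ω : Set Plane)]
      fun x => ∇ φ x) : p = testH1 φ := by
  refine Subtype.ext (WithLp.ofLp_injective 2 (Prod.ext (Lp.ext ?_) (Lp.ext ?_)))
  · exact h.trans (coeFn_val_testH1 φ).symm
  · exact h'.trans (coeFn_grad_testH1 φ).symm

lemma locallyIntegrableOn_L2 {F : Type} [NormedAddCommGroup F] (g : L2 Ω F) :
    LocallyIntegrableOn (g : Plane → F) (Ω : Set Plane) volume :=
  locallyIntegrableOn_of_locallyIntegrable_restrict ((Lp.memLp g).locallyIntegrable (by norm_num))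

/-- An `L²` function that annihilates all test functions vanishes. -/
lemma eq_zero_of_integral_test_smul {F : Type} [NormedAddCommGroup F] [NormedSpace ℝ F]
    [CompleteSpace F] (g : L2 Ω F)
    (h : ∀ φ : 𝓓(Ω, ℝ), ∫ x in (Ω : Set Plane), φ x • g x = 0) : g = 0 := by
  rw [Lp.eq_zero_iff_ae_eq_zero]
  refine (ae_restrict_iff' Ω.isOpen.measurableSet).2 ?_
  refine Ω.isOpen.ae_eq_zero_of_integral_contDiff_smul_eq_zero (locallyIntegrableOn_L2 g) ?_
  intro ψ h1 h2 h3
  rw [← h ⟨ψ, h1, h2, h3⟩, eq_comm]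
  exact setIntegral_eq_integral_of_forall_compl_eq_zero fun x hx => by
    rw [testFunction_eq_zero ⟨ψ, h1, h2, h3⟩ hx, zero_smul]

lemma eq_zero_of_inner_testH1 (g : L2 Ω ℝ)
    (h : ∀ φ : 𝓓(Ω, ℝ), inner ℝ g (H1.val (testH1 φ)) = 0) : g = 0 := by
  refine eq_zero_of_integral_test_smul g fun φ => ?_
  rw [← h φ, L2.inner_def]
  refine integral_congr_ae ?_
  filter_upwards [coeFn_val_testH1 φ] with x hx
  rw [hx]
  simp

lemma H1.val_injective : Function.Injective (H1.val : H1 K → L2 K ℝ) := by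
  intro u v huv
  refine Subtype.ext (WithLp.ofLp_injective 2 (Prod.ext huv ?_))
  refine sub_eq_zero.1 (eq_zero_of_integral_test_smul (H1.grad u - H1.grad v) fun φ => ?_)
  have h : ∫ x in (K : Set Plane), (H1.val (u - v)) x • ∇ φ x =
      -∫ x in (K : Set Plane), φ x • (H1.grad u - H1.grad v) x := (u - v).2 φ
  have h0 : H1.val (u - v) = 0 := sub_eq_zero.2 huv
  rw [h0] at h
  refine neg_eq_zero.1 (h.symm.trans (integral_eq_zero_of_ae ?_))
  filter_upwards [Lp.coeFn_zero ℝ 2 (volume.restrict (K : Set Plane))] with x hx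
  rw [hx]
  simp

end TestFunctions

section Completeness

variable {K Ω : Opens Plane}

/-- `u ↦ ∫ u ∇φ`. -/
lemma continuous_integral_smul_gradient (φ : 𝓓(K, ℝ)) :
    Continuous fun u : L2 Ω ℝ => ∫ x in (Ω : Set Plane), u x • ∇ φ x := by
  have := ((ContinuousLinearMap.lsmul ℝ ℝ (E := Plane)).lpPairing
    (volume.restrict (Ω : Set Plane)) 2 2).flip
    ((memLp_gradient φ (volume.restrict (Ω : Set Plane))).toLp (fun x => ∇ φ x)) |>.continuous
  refine this.congr fun u => ?_
  rw [ContinuousLinearMap.flip_apply, ContinuousLinearMap.lpPairing_eq_integral]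
  refine integral_congr_ae ?_
  filter_upwards [(memLp_gradient φ (volume.restrict (Ω : Set Plane))).coeFn_toLp] with x hx
  rw [hx]
  rfl

lemma continuous_integral_smul_field (φ : 𝓓(K, ℝ)) :
    Continuous fun g : L2 Ω Plane => ∫ x in (Ω : Set Plane), φ x • g x := by
  have := ((ContinuousLinearMap.lsmul ℝ ℝ (E := Plane)).lpPairing
    (volume.restrict (Ω : Set Plane)) 2 2)
    ((memLp_testFunction φ (volume.restrict (Ω : Set Plane))).toLp φ) |>.continuous
  refine this.congr fun u => ?_
  rw [ContinuousLinearMap.lpPairing_eq_integral]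
  refine integral_congr_ae ?_
  filter_upwards [(memLp_testFunction φ (volume.restrict (Ω : Set Plane))).coeFn_toLp] with x hx
  rw [hx]
  rfl

lemma isClosed_H1 : IsClosed (H1 K : Set (WithLp 2 (L2 K ℝ × L2 K Plane))) := by
  have : (H1 K : Set (WithLp 2 (L2 K ℝ × L2 K Plane))) = ⋂ φ : 𝓓(K, ℝ),
      {p | ∫ x in (K : Set Plane), p.fst x • ∇ φ x =
        -∫ x in (K : Set Plane), φ x • p.snd x} := by
    ext p
    simp only [Set.mem_iInter]
    rfl
  rw [this]
  refine isClosed_iInter fun φ => isClosed_eq ?_ ?_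
  · exact (continuous_integral_smul_gradient φ).comp (WithLp.prod_continuous_ofLp 2 _ _).fst
  · exact ((continuous_integral_smul_field φ).comp (WithLp.prod_continuous_ofLp 2 _ _).snd).neg

instance : CompleteSpace (H1 K) := isClosed_H1.completeSpace_coe

instance : CompleteSpace (H10 K) :=
  (smoothH1 K).isClosed_topologicalClosure.completeSpace_coe

end Completeness

lemma sq_lintegral_le_lintegral_sq {α : Type*} [MeasurableSpace α] {ν : Measure α}
    [IsProbabilityMeasure ν] {f : α → ℝ≥0∞} (hf : AEMeasurable f ν) :
    (∫⁻ a, f a ∂ν) ^ 2 ≤ ∫⁻ a, f a ^ 2 ∂ν := by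
  have h := ENNReal.lintegral_mul_le_Lp_mul_Lq ν Real.HolderConjugate.two_two hf
    (aemeasurable_const (b := (1 : ℝ≥0∞)))
  simp only [Pi.mul_apply, mul_one, ENNReal.one_rpow, lintegral_one, measure_univ] at h
  calc (∫⁻ a, f a ∂ν) ^ 2 ≤ ((∫⁻ a, f a ^ (2 : ℝ) ∂ν) ^ (1 / 2 : ℝ)) ^ 2 := by gcongr
    _ = ∫⁻ a, f a ^ 2 ∂ν := by
      rw [← ENNReal.rpow_natCast, ← ENNReal.rpow_mul]
      simp

section Translation

variable {K Ω : Opens Plane}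

lemma enorm_sub_translate_sq_le (φ : 𝓓(K, ℝ)) (x h : Plane) :
    ‖φ (x + h) - φ x‖ₑ ^ 2 ≤
      ∫⁻ t in Set.Ioc (0 : ℝ) 1, ‖h‖ₑ ^ 2 * ‖∇ φ (x + t • h)‖ₑ ^ 2 := by
  have hd : ∀ t : ℝ, HasDerivAt (fun t : ℝ => φ (x + t • h)) (inner ℝ (∇ φ (x + t • h)) h) t := by
    intro t
    rw [inner_gradient]
    have h1 : HasDerivAt (fun t : ℝ => x + t • h) h t := by
      simpa using ((hasDerivAt_id t).smul_const h).const_add x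
    exact ((φ.contDiff.differentiable (by simp)).differentiableAt.hasFDerivAt).comp_hasDerivAt t h1
  have hc : Continuous fun t : ℝ => inner ℝ (∇ φ (x + t • h)) h :=
    ((continuous_gradient φ).comp (by fun_prop)).inner continuous_const
  have e := intervalIntegral.integral_eq_sub_of_hasDerivAt (fun t _ => hd t)
    (hc.intervalIntegrable 0 1)
  simp only [one_smul, zero_smul, add_zero] at e
  rw [← e, intervalIntegral.integral_of_le zero_le_one]
  have : IsProbabilityMeasure (volume.restrict (Set.Ioc (0 : ℝ) 1)) := ⟨by simp⟩
  calc ‖∫ t in Set.Ioc (0 : ℝ) 1, inner ℝ (∇ φ (x + t • h)) h‖ₑ ^ 2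
      ≤ (∫⁻ t in Set.Ioc (0 : ℝ) 1, ‖inner ℝ (∇ φ (x + t • h)) h‖ₑ) ^ 2 := by
        gcongr
        exact enorm_integral_le_lintegral_enorm _
    _ ≤ ∫⁻ t in Set.Ioc (0 : ℝ) 1, ‖inner ℝ (∇ φ (x + t • h)) h‖ₑ ^ 2 :=
        sq_lintegral_le_lintegral_sq hc.enorm.measurable.aemeasurable
    _ ≤ _ := by
        refine lintegral_mono fun t => ?_
        rw [← mul_pow, mul_comm]
        gcongr
        rw [← enorm_norm h, ← enorm_norm (∇ φ (x + t • h)), ← enorm_mul]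
        exact enorm_le_iff_norm_le.2
          (by simpa using norm_inner_le_norm (𝕜 := ℝ) (∇ φ (x + t • h)) h)

/-- Translations are Lipschitz in `L²` along functions with square integrable gradient. -/
lemma lintegral_sub_translate_sq_le (φ : 𝓓(K, ℝ)) (h : Plane) :
    ∫⁻ x, ‖φ (x + h) - φ x‖ₑ ^ 2 ≤ ‖h‖ₑ ^ 2 * ∫⁻ x, ‖∇ φ x‖ₑ ^ 2 := by
  have hm : Continuous fun p : Plane × ℝ => ∇ φ (p.1 + p.2 • h) :=
    (continuous_gradient φ).comp (by fun_prop)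
  calc ∫⁻ x, ‖φ (x + h) - φ x‖ₑ ^ 2
      ≤ ∫⁻ x, ∫⁻ t in Set.Ioc (0 : ℝ) 1, ‖h‖ₑ ^ 2 * ‖∇ φ (x + t • h)‖ₑ ^ 2 :=
        lintegral_mono fun x => enorm_sub_translate_sq_le φ x h
    _ = ∫⁻ t in Set.Ioc (0 : ℝ) 1, ∫⁻ x, ‖h‖ₑ ^ 2 * ‖∇ φ (x + t • h)‖ₑ ^ 2 :=
        lintegral_lintegral_swap
          ((hm.enorm.measurable.pow_const 2).const_mul _).aemeasurable
    _ = ∫⁻ t in Set.Ioc (0 : ℝ) 1, ‖h‖ₑ ^ 2 * ∫⁻ x, ‖∇ φ x‖ₑ ^ 2 := by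
        refine lintegral_congr fun t => ?_
        rw [lintegral_const_mul' _ _ (by simp),
          lintegral_add_right_eq_self (fun x => ‖∇ φ x‖ₑ ^ 2)]
    _ = _ := by simp

/-- The uniform probability measure on a ball. -/
def ballMeasure (ε : ℝ) : Measure Plane := ProbabilityTheory.cond volume (Metric.ball 0 ε)

lemma isProbabilityMeasure_ballMeasure {ε : ℝ} (hε : 0 < ε) :
    IsProbabilityMeasure (ballMeasure ε) :=
  ProbabilityTheory.cond_isProbabilityMeasure_of_finite (Metric.measure_ball_pos _ _ hε).ne'
    measure_ball_lt_top.ne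

/-- The mean of `φ` over the ball of radius `ε` centred at `x`. -/
def ballMean (ε : ℝ) (φ : Plane → ℝ) (x : Plane) : ℝ := ∫ h, φ (x + h) ∂ballMeasure ε

lemma integrable_translate {ε : ℝ} (hε : 0 < ε) (φ : 𝓓(K, ℝ)) (x : Plane) :
    Integrable (fun h => φ (x + h)) (ballMeasure ε) := by
  have := isProbabilityMeasure_ballMeasure hε
  obtain ⟨C, hC⟩ := φ.continuous.bounded_above_of_compact_support φ.hasCompactSupport
  exact Integrable.of_bound (φ.continuous.comp (by fun_prop)).aestronglyMeasurable C
    (Filter.Eventually.of_forall fun h => hC _)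

lemma lintegral_ballMean_sub_sq_le {ε : ℝ} (hε : 0 < ε) (φ : 𝓓(K, ℝ)) :
    ∫⁻ x, ‖ballMean ε φ x - φ x‖ₑ ^ 2 ≤ ENNReal.ofReal ε ^ 2 * ∫⁻ x, ‖∇ φ x‖ₑ ^ 2 := by
  have := isProbabilityMeasure_ballMeasure hε
  have hm : Continuous fun p : Plane × Plane => φ (p.1 + p.2) - φ p.1 :=
    (φ.continuous.comp (by fun_prop)).sub (φ.continuous.comp (by fun_prop))
  calc ∫⁻ x, ‖ballMean ε φ x - φ x‖ₑ ^ 2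
      ≤ ∫⁻ x, ∫⁻ h, ‖φ (x + h) - φ x‖ₑ ^ 2 ∂ballMeasure ε := by
        refine lintegral_mono fun x => ?_
        have e : ballMean ε φ x - φ x = ∫ h, (φ (x + h) - φ x) ∂ballMeasure ε := by
          rw [integral_sub (integrable_translate hε φ x) (integrable_const _)]
          simp [ballMean]
        rw [e]
        have hm' : Measurable fun h => ‖φ (x + h) - φ x‖ₑ :=
          (hm.comp (Continuous.prodMk_right x)).enorm.measurable
        refine le_trans ?_ (sq_lintegral_le_lintegral_sq hm'.aemeasurable)
        gcongr
        exact enorm_integral_le_lintegral_enorm _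
    _ = ∫⁻ h, (∫⁻ x, ‖φ (x + h) - φ x‖ₑ ^ 2) ∂ballMeasure ε :=
        lintegral_lintegral_swap (f := fun x h => ‖φ (x + h) - φ x‖ₑ ^ 2)
          (hm.enorm.measurable.pow_const 2).aemeasurable
    _ ≤ ∫⁻ _, (ENNReal.ofReal ε ^ 2 * ∫⁻ x, ‖∇ φ x‖ₑ ^ 2) ∂ballMeasure ε := by
        refine lintegral_mono_ae ?_
        have hb : ∀ᵐ h ∂ballMeasure ε, h ∈ Metric.ball (0 : Plane) ε :=
          ProbabilityTheory.ae_cond_mem measurableSet_ball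
        filter_upwards [hb] with h hh
        refine (lintegral_sub_translate_sq_le φ h).trans ?_
        gcongr
        rw [← ofReal_norm]
        exact ENNReal.ofReal_le_ofReal (by simpa using (Metric.mem_ball.1 hh).le)
    _ = _ := by simp

lemma enorm_ballMean_sub_sq_le {ε : ℝ} (hε : 0 < ε) (φ : 𝓓(K, ℝ)) (x y : Plane) :
    ‖ballMean ε φ x - ballMean ε φ y‖ₑ ^ 2 ≤
      (volume (Metric.ball (0 : Plane) ε))⁻¹ * (‖x - y‖ₑ ^ 2 * ∫⁻ x, ‖∇ φ x‖ₑ ^ 2) := by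
  have := isProbabilityMeasure_ballMeasure hε
  have e : ballMean ε φ x - ballMean ε φ y = ∫ h, (φ (x + h) - φ (y + h)) ∂ballMeasure ε :=
    (integral_sub (integrable_translate hε φ x) (integrable_translate hε φ y)).symm
  have hm : Continuous fun h => φ (x + h) - φ (y + h) :=
    (φ.continuous.comp (by fun_prop)).sub (φ.continuous.comp (by fun_prop))
  calc ‖ballMean ε φ x - ballMean ε φ y‖ₑ ^ 2
      ≤ (∫⁻ h, ‖φ (x + h) - φ (y + h)‖ₑ ∂ballMeasure ε) ^ 2 := by
        rw [e]
        gcongr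
        exact enorm_integral_le_lintegral_enorm _
    _ ≤ ∫⁻ h, ‖φ (x + h) - φ (y + h)‖ₑ ^ 2 ∂ballMeasure ε :=
        sq_lintegral_le_lintegral_sq hm.enorm.measurable.aemeasurable
    _ ≤ (volume (Metric.ball (0 : Plane) ε))⁻¹ * ∫⁻ h, ‖φ (x + h) - φ (y + h)‖ₑ ^ 2 := by
        rw [ballMeasure, ProbabilityTheory.cond, lintegral_smul_measure, smul_eq_mul]
        gcongr
        exact Measure.restrict_le_self
    _ = (volume (Metric.ball (0 : Plane) ε))⁻¹ * ∫⁻ h, ‖φ (h + (x - y)) - φ h‖ₑ ^ 2 := by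
        congr 1
        rw [← lintegral_add_right_eq_self (fun h => ‖φ (h + (x - y)) - φ h‖ₑ ^ 2) y]
        refine lintegral_congr fun h => ?_
        congr 4 <;> abel
    _ ≤ _ := by
        gcongr
        exact lintegral_sub_translate_sq_le φ (x - y)

end Translation

section Density

variable {Ω : Opens Plane}

lemma gradient_add_test (φ ψ : 𝓓(Ω, ℝ)) (x : Plane) : ∇ (φ + ψ) x = ∇ φ x + ∇ ψ x := by
  simp only [gradient]
  rw [← map_add]
  congr 1
  exact fderiv_add (φ.contDiff.differentiable (by simp)).differentiableAt
    (ψ.contDiff.differentiable (by simp)).differentiableAt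

lemma gradient_smul_test (c : ℝ) (φ : 𝓓(Ω, ℝ)) (x : Plane) : ∇ (c • φ) x = c • ∇ φ x := by
  simp only [gradient]
  rw [← map_smul]
  congr 1
  exact fderiv_const_smul (φ.contDiff.differentiable (by simp)).differentiableAt c

lemma testH1_add (φ ψ : 𝓓(Ω, ℝ)) : testH1 φ + testH1 ψ = testH1 (φ + ψ) := by
  refine testH1_eq ?_ ?_
  · refine (Lp.coeFn_add (H1.val (testH1 φ)) (H1.val (testH1 ψ))).trans ?_
    filter_upwards [coeFn_val_testH1 φ, coeFn_val_testH1 ψ] with x h1 h2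
    rw [Pi.add_apply, h1, h2]
    rfl
  · refine (Lp.coeFn_add (H1.grad (testH1 φ)) (H1.grad (testH1 ψ))).trans ?_
    filter_upwards [coeFn_grad_testH1 φ, coeFn_grad_testH1 ψ] with x h1 h2
    rw [Pi.add_apply, h1, h2]
    exact (gradient_add_test φ ψ x).symm

lemma testH1_smul (c : ℝ) (φ : 𝓓(Ω, ℝ)) : c • testH1 φ = testH1 (c • φ) := by
  refine testH1_eq ?_ ?_
  · refine (Lp.coeFn_smul c (H1.val (testH1 φ))).trans ?_
    filter_upwards [coeFn_val_testH1 φ] with x h1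
    rw [Pi.smul_apply, h1]
    rfl
  · refine (Lp.coeFn_smul c (H1.grad (testH1 φ))).trans ?_
    filter_upwards [coeFn_grad_testH1 φ] with x h1
    rw [Pi.smul_apply, h1]
    exact (gradient_smul_test c φ x).symm

lemma exists_eq_testH1 {p : H1 Ω} (hp : p ∈ smoothH1 Ω) : ∃ φ : 𝓓(Ω, ℝ), p = testH1 φ := by
  induction hp using Submodule.span_induction with
  | mem p h =>
    obtain ⟨φ, h1, h2⟩ := h
    exact ⟨φ, testH1_eq h1 h2⟩
  | zero => exact ⟨0, by simpa using testH1_smul (0 : ℝ) (0 : 𝓓(Ω, ℝ))⟩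
  | add p q _ _ hp hq =>
    obtain ⟨φ, rfl⟩ := hp
    obtain ⟨ψ, rfl⟩ := hq
    exact ⟨φ + ψ, testH1_add φ ψ⟩
  | smul c p _ hp =>
    obtain ⟨φ, rfl⟩ := hp
    exact ⟨c • φ, testH1_smul c φ⟩

/-- A closed condition that holds for test functions holds on `H¹₀`. -/
lemma H10_induction {p : H1 Ω → Prop} (hc : IsClosed {u | p u}) (h : ∀ φ : 𝓓(Ω, ℝ), p (testH1 φ))
    {u : H1 Ω} (hu : u ∈ H10 Ω) : p u := by
  have hs : (smoothH1 Ω : Set (H1 Ω)) ⊆ {u | p u} := fun v hv => by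
    obtain ⟨φ, rfl⟩ := exists_eq_testH1 hv
    exact h φ
  exact closure_minimal hs hc hu

/-- `u ↦ u` as a map `H¹ → L²`. -/
def valCLM (K : Opens Plane) : H1 K →L[ℝ] L2 K ℝ :=
  ContinuousLinearMap.fst ℝ _ _ ∘L
    (WithLp.prodContinuousLinearEquiv 2 ℝ (L2 K ℝ) (L2 K Plane)).toContinuousLinearMap ∘L
      (H1 K).subtypeL

/-- `u ↦ ∇u` as a map `H¹ → L²`. -/
def gradCLM (K : Opens Plane) : H1 K →L[ℝ] L2 K Plane :=
  ContinuousLinearMap.snd ℝ _ _ ∘L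
    (WithLp.prodContinuousLinearEquiv 2 ℝ (L2 K ℝ) (L2 K Plane)).toContinuousLinearMap ∘L
      (H1 K).subtypeL

@[simp] lemma valCLM_apply (u : H1 Ω) : valCLM Ω u = H1.val u := rfl

@[simp] lemma gradCLM_apply (u : H1 Ω) : gradCLM Ω u = H1.grad u := rfl

lemma norm_sq_H1 (u : H1 Ω) : ‖u‖ ^ 2 = ‖H1.val u‖ ^ 2 + ‖H1.grad u‖ ^ 2 :=
  WithLp.prod_norm_sq_eq_of_L2 _

lemma enorm_sq_L2 {F : Type} [NormedAddCommGroup F] {f : L2 Ω F} {g : Plane → F}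
    (h : f =ᵐ[volume.restrict (Ω : Set Plane)] g) (h0 : ∀ x ∉ (Ω : Set Plane), g x = 0) :
    ‖f‖ₑ ^ 2 = ∫⁻ x, ‖g x‖ₑ ^ 2 := by
  rw [Lp.enorm_def, eLpNorm_congr_ae h, eLpNorm_restrict_eq_of_support_subset
    (Function.support_subset_iff'.2 h0), eLpNorm_eq_lintegral_rpow_enorm_toReal (by simp) (by simp),
    ← ENNReal.rpow_natCast, ← ENNReal.rpow_mul]
  simp

lemma enorm_sq_val_testH1 (φ : 𝓓(Ω, ℝ)) : ‖H1.val (testH1 φ)‖ₑ ^ 2 = ∫⁻ x, ‖φ x‖ₑ ^ 2 :=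
  enorm_sq_L2 (coeFn_val_testH1 φ) fun _ => testFunction_eq_zero φ

lemma enorm_sq_grad_testH1 (φ : 𝓓(Ω, ℝ)) : ‖H1.grad (testH1 φ)‖ₑ ^ 2 = ∫⁻ x, ‖∇ φ x‖ₑ ^ 2 :=
  enorm_sq_L2 (coeFn_grad_testH1 φ) fun _ => gradient_eq_zero_of_notMem φ

/-- Poincaré's inequality. -/
lemma exists_poincare (hΩ : Bornology.IsBounded (Ω : Set Plane)) :
    ∃ C : ℝ, 0 < C ∧ ∀ u ∈ H10 Ω, ‖H1.val u‖ ≤ C * ‖H1.grad u‖ := by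
  obtain ⟨r, hr0, hr⟩ := hΩ.exists_pos_norm_lt
  refine ⟨2 * r, by positivity, fun u hu => ?_⟩
  refine H10_induction (p := fun u => ‖H1.val u‖ ≤ 2 * r * ‖H1.grad u‖)
    (isClosed_le (valCLM Ω).continuous.norm ((gradCLM Ω).continuous.norm.const_mul _)) ?_ hu
  intro φ
  set h : Plane := EuclideanSpace.single 0 (2 * r) with hh
  have hn : ‖h‖ = 2 * r := by simp [hh, abs_of_pos hr0]
  have key : ‖H1.val (testH1 φ)‖ₑ ^ 2 ≤ (‖h‖ₑ * ‖H1.grad (testH1 φ)‖ₑ) ^ 2 := by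
    rw [mul_pow, enorm_sq_val_testH1, enorm_sq_grad_testH1]
    refine le_trans (lintegral_mono fun x => ?_) (lintegral_sub_translate_sq_le φ h)
    by_cases hx : x ∈ (Ω : Set Plane)
    · have : x + h ∉ (Ω : Set Plane) := fun hxh => by
        have h1 := hr _ hx
        have h2 := hr _ hxh
        have h3 : ‖h‖ ≤ ‖x + h‖ + ‖x‖ := by simpa using norm_sub_le (x + h) x
        linarith
      simp [testFunction_eq_zero φ this]
    · simp [testFunction_eq_zero φ hx]
  have key' := (ENNReal.pow_le_pow_left_iff (by norm_num : (2 : ℕ) ≠ 0)).1 key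
  rw [← hn]
  rw [← enorm_norm h, ← enorm_norm (H1.grad (testH1 φ)), ← enorm_mul] at key'
  simpa using enorm_le_iff_norm_le.1 key'

lemma enorm_sq_le_two_mul (a b : ℝ) : ‖b‖ₑ ^ 2 ≤ 2 * ‖a - b‖ₑ ^ 2 + 2 * ‖a‖ₑ ^ 2 := by
  have e : ∀ z : ℝ, ‖z‖ₑ ^ 2 = ENNReal.ofReal (z ^ 2) := fun z => by
    rw [← ofReal_norm, ← ENNReal.ofReal_pow (norm_nonneg _), Real.norm_eq_abs, sq_abs]
  rw [e, e, e, ← ENNReal.ofReal_ofNat 2, ← ENNReal.ofReal_mul (by norm_num),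
    ← ENNReal.ofReal_mul (by norm_num), ← ENNReal.ofReal_add (by positivity) (by positivity)]
  exact ENNReal.ofReal_le_ofReal (by nlinarith [sq_nonneg (2 * a - b)])

/-- Means over balls extend to continuous functionals on `L²`. -/
lemma exists_ballMean_functional {ε : ℝ} (x : Plane) :
    ∃ ℓ : L2 Ω ℝ →L[ℝ] ℝ, ∀ φ : 𝓓(Ω, ℝ), ℓ (H1.val (testH1 φ)) = ballMean ε φ x := by
  have hm : MeasurableSet (Metric.ball x ε) := measurableSet_ball
  have hk : MemLp ((Metric.ball x ε).indicator fun _ => (1 : ℝ)) 2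
      (volume.restrict (Ω : Set Plane)) :=
    memLp_indicator_const 2 hm 1 (Or.inr
      (((Measure.restrict_apply_le _ _).trans_lt measure_ball_lt_top).ne))
  refine ⟨(volume (Metric.ball (0 : Plane) ε))⁻¹.toReal • innerSL ℝ (hk.toLp _), fun φ => ?_⟩
  rw [smul_apply, innerSL_apply_apply, L2.inner_def, ballMean, ballMeasure,
    ProbabilityTheory.cond, integral_smul_measure]
  congr 1
  calc _ = ∫ y in (Ω : Set Plane), (Metric.ball x ε).indicator (fun y => φ y) y := by
        refine integral_congr_ae ?_
        filter_upwards [hk.coeFn_toLp, coeFn_val_testH1 φ] with y h1 h2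
        rw [h1, h2]
        by_cases hy : y ∈ Metric.ball x ε <;> simp [hy]
    _ = ∫ y, (Metric.ball x ε).indicator (fun y => φ y) y :=
        setIntegral_eq_integral_of_forall_compl_eq_zero fun y hy => by
          simp [Set.indicator, testFunction_eq_zero φ hy]
    _ = ∫ h, (Metric.ball x ε).indicator (fun y => φ y) (x + h) :=
        (integral_add_left_eq_self _ x).symm
    _ = ∫ h, (Metric.ball 0 ε).indicator (fun h => φ (x + h)) h := by
        congr 1 with h
        simp [Set.indicator]
    _ = _ := integral_indicator measurableSet_ball

/-- Up to a small multiple of the gradient, finitely many functionals control the `L²` norm. -/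
lemma exists_finite_functionals (hΩ : Bornology.IsBounded (Ω : Set Plane)) {δ : ℝ} (hδ : 0 < δ) :
    ∃ (ι : Type) (_ : Fintype ι) (ℓ : L2 Ω ℝ →L[ℝ] (ι → ℝ)), ∀ u ∈ H10 Ω,
      ‖H1.val u‖ ^ 2 ≤ δ * ‖H1.grad u‖ ^ 2 + ‖ℓ (H1.val u)‖ ^ 2 := by
  obtain ⟨ε, hε, hε2⟩ : ∃ ε : ℝ, 0 < ε ∧ 2 * ε ^ 2 = δ / 2 :=
    ⟨Real.sqrt (δ / 4), by positivity, by rw [Real.sq_sqrt (by positivity)]; ring⟩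
  set B := volume (Metric.ball (0 : Plane) ε) with hB
  have hB0 : B ≠ 0 := (Metric.measure_ball_pos _ _ hε).ne'
  obtain ⟨c, hc⟩ : ∃ c : ℝ, c = B⁻¹.toReal := ⟨_, rfl⟩
  have hc0 : 0 ≤ c := by rw [hc]; positivity
  have hcB : B⁻¹ = ENNReal.ofReal c := by rw [hc, ENNReal.ofReal_toReal (by simpa using hB0)]
  set V := (volume (Ω : Set Plane)).toReal with hV
  have hVB : volume (Ω : Set Plane) = ENNReal.ofReal V :=
    (ENNReal.ofReal_toReal hΩ.measure_lt_top.ne).symm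
  have hV0 : 0 ≤ V := ENNReal.toReal_nonneg
  obtain ⟨η, hη, hη2⟩ : ∃ η : ℝ, 0 < η ∧ V * (4 * c * η ^ 2) ≤ δ / 2 := by
    refine ⟨Real.sqrt (δ / (8 * (V * c + 1))), by positivity, ?_⟩
    rw [Real.sq_sqrt (by positivity)]
    have : V * (4 * c * (δ / (8 * (V * c + 1)))) = δ / 2 * (V * c / (V * c + 1)) := by
      field_simp
      ring
    rw [this]
    refine mul_le_of_le_one_right (by positivity) ?_
    rw [div_le_one (by positivity)]
    linarith
  obtain ⟨t, ht, hcov⟩ := Metric.totallyBounded_iff.1 (hΩ.isCompact_closure.totallyBounded.subset subset_closure) η hη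
  have := ht.fintype
  choose ℓ hℓ using fun y : Plane => exists_ballMean_functional (Ω := Ω) (ε := ε) y
  refine ⟨t, inferInstance, (2 * Real.sqrt V) • ContinuousLinearMap.pi fun y : t => ℓ y,
    fun u hu => ?_⟩
  set Λ : L2 Ω ℝ →L[ℝ] (t → ℝ) := ContinuousLinearMap.pi fun y : t => ℓ y with hΛ
  have hs : ∀ v, ‖((2 * Real.sqrt V) • Λ) v‖ ^ 2 = V * (4 * ‖Λ v‖ ^ 2) := fun v => by
    rw [smul_apply, norm_smul, mul_pow, Real.norm_eq_abs, sq_abs, mul_pow,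
      Real.sq_sqrt hV0]
    ring
  simp only [hs]
  refine H10_induction
    (p := fun u => ‖H1.val u‖ ^ 2 ≤ δ * ‖H1.grad u‖ ^ 2 + V * (4 * ‖Λ (H1.val u)‖ ^ 2)) ?_ ?_ hu
  · have h1 := (valCLM Ω).continuous
    have h2 := (gradCLM Ω).continuous
    have h3 := Λ.continuous.comp h1
    exact isClosed_le (h1.norm.pow 2)
      (((h2.norm.pow 2).const_mul _).add (((h3.norm.pow 2).const_mul _).const_mul _))
  intro φ
  set g := H1.grad (testH1 φ) with hg
  set v := H1.val (testH1 φ) with hv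
  have hG : ∫⁻ x, ‖∇ φ x‖ₑ ^ 2 = ‖g‖ₑ ^ 2 := (enorm_sq_grad_testH1 φ).symm
  have hpt : ∀ x ∈ (Ω : Set Plane), ‖ballMean ε φ x‖ₑ ^ 2 ≤
      2 * (B⁻¹ * (ENNReal.ofReal η ^ 2 * ‖g‖ₑ ^ 2)) + 2 * ‖Λ v‖ₑ ^ 2 := by
    intro x hx
    obtain ⟨y, hy, hxy⟩ := Set.mem_iUnion₂.1 (hcov hx)
    refine (enorm_sq_le_two_mul (ballMean ε φ y) _).trans ?_
    gcongr
    · refine (enorm_ballMean_sub_sq_le hε φ y x).trans ?_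
      rw [hG]
      gcongr
      rw [← ofReal_norm, ← dist_eq_norm, dist_comm]
      exact ENNReal.ofReal_le_ofReal (Metric.mem_ball.1 hxy).le
    · rw [← hℓ y φ]
      exact enorm_le_iff_norm_le.2 (norm_le_pi_norm (Λ v) ⟨y, hy⟩)
  have key : ‖v‖ₑ ^ 2 ≤ 2 * (ENNReal.ofReal ε ^ 2 * ‖g‖ₑ ^ 2) +
      volume (Ω : Set Plane) *
        (2 * (2 * (B⁻¹ * (ENNReal.ofReal η ^ 2 * ‖g‖ₑ ^ 2)) + 2 * ‖Λ v‖ₑ ^ 2)) := by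
    have := isProbabilityMeasure_ballMeasure hε
    have hmb : Measurable (ballMean ε φ) := by
      have hc : Continuous fun p : Plane × Plane => φ (p.1 + p.2) :=
        φ.continuous.comp (by fun_prop)
      exact (hc.stronglyMeasurable.integral_prod_right (ν := ballMeasure ε)).measurable
    have hmeas : Measurable fun x => 2 * ‖ballMean ε φ x - φ x‖ₑ ^ 2 :=
      ((hmb.sub φ.continuous.measurable).enorm.pow_const 2).const_mul 2
    calc ‖v‖ₑ ^ 2 = ∫⁻ x in (Ω : Set Plane), ‖φ x‖ₑ ^ 2 := by
          rw [hv, enorm_sq_val_testH1, ← lintegral_indicator Ω.isOpen.measurableSet]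
          refine lintegral_congr fun x => ?_
          by_cases hx : x ∈ (Ω : Set Plane)
          · rw [Set.indicator_of_mem hx]
          · simp [Set.indicator_of_notMem hx, testFunction_eq_zero φ hx]
      _ ≤ ∫⁻ x in (Ω : Set Plane), (2 * ‖ballMean ε φ x - φ x‖ₑ ^ 2 +
            2 * (2 * (B⁻¹ * (ENNReal.ofReal η ^ 2 * ‖g‖ₑ ^ 2)) + 2 * ‖Λ v‖ₑ ^ 2)) := by
          refine setLIntegral_mono' Ω.isOpen.measurableSet fun x hx => ?_
          refine (enorm_sq_le_two_mul (ballMean ε φ x) _).trans ?_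
          gcongr
          exact hpt x hx
      _ ≤ _ := by
          rw [lintegral_add_left hmeas, setLIntegral_const, mul_comm (volume _)]
          gcongr
          refine (setLIntegral_le_lintegral _ _).trans ?_
          rw [lintegral_const_mul' _ _ (by simp), ← hG]
          gcongr
          exact lintegral_ballMean_sub_sq_le hε φ
  have h2 : ∀ z : ℝ≥0∞, 2 * z = ENNReal.ofReal 2 * z := fun z => by simp
  rw [hcB, hVB, ← ofReal_norm v, ← ofReal_norm g, ← ofReal_norm (Λ v)] at key
  have p1 := norm_nonneg v
  have p2 := norm_nonneg g
  have p3 := norm_nonneg (Λ v)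
  generalize ‖v‖ = a at *
  generalize ‖g‖ = b at *
  generalize ‖Λ v‖ = d at *
  simp only [h2, ← ENNReal.ofReal_pow hε.le, ← ENNReal.ofReal_pow hη.le, ← ENNReal.ofReal_pow p1,
    ← ENNReal.ofReal_pow p2, ← ENNReal.ofReal_pow p3] at key
  rw [← ENNReal.ofReal_mul (by positivity), ← ENNReal.ofReal_mul (by positivity),
    ← ENNReal.ofReal_mul (by positivity), ← ENNReal.ofReal_mul (by positivity),
    ← ENNReal.ofReal_mul (by positivity), ← ENNReal.ofReal_mul (by positivity),
    ← ENNReal.ofReal_add (by positivity) (by positivity), ← ENNReal.ofReal_mul (by positivity),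
    ← ENNReal.ofReal_mul (by positivity), ← ENNReal.ofReal_add (by positivity) (by positivity),
    ENNReal.ofReal_le_ofReal_iff (by positivity)] at key
  nlinarith [mul_le_mul_of_nonneg_right hη2 (sq_nonneg b), congrArg (· * b ^ 2) hε2]

end Density

section Compactness

lemma isCompactOperator_of_finite_functionals {H G : Type} [NormedAddCommGroup H]
    [NormedSpace ℝ H] [NormedAddCommGroup G] [NormedSpace ℝ G] [CompleteSpace G] (j : H →L[ℝ] G)
    (h : ∀ δ : ℝ, 0 < δ → ∃ (ι : Type) (_ : Fintype ι) (ℓ : H →L[ℝ] (ι → ℝ)),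
      ∀ u, ‖j u‖ ≤ δ * ‖u‖ + ‖ℓ u‖) : IsCompactOperator j := by
  refine (isCompactOperator_iff_isCompact_closure_image_ball (j : H →ₗ[ℝ] G) one_pos).2 ?_
  refine TotallyBounded.isCompact_of_isClosed (TotallyBounded.closure ?_) isClosed_closure
  refine Metric.totallyBounded_of_finite_discretization fun ε hε => ?_
  obtain ⟨ι, _, ℓ, hℓ⟩ := h (ε / 4) (by positivity)
  have hb : Bornology.IsBounded (ℓ '' Metric.ball 0 1) :=
    ℓ.lipschitz.isBounded_image Metric.isBounded_ball
  obtain ⟨t, ht, hcov⟩ := Metric.totallyBounded_iff.1 (hb.isCompact_closure.totallyBounded.subset subset_closure) (ε / 4) (by positivity)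
  have := ht.fintype
  choose u hu hju using fun x : (j : H →ₗ[ℝ] G) '' Metric.ball 0 1 => x.2
  have hy : ∀ x, ∃ y ∈ t, ℓ (u x) ∈ Metric.ball y (ε / 4) := fun x => by
    simpa using hcov (Set.mem_image_of_mem ℓ (hu x))
  choose y hyt hyb using hy
  refine ⟨t, inferInstance, fun x => ⟨y x, hyt x⟩, fun a b hab => ?_⟩
  have hab' : y a = y b := congrArg Subtype.val hab
  rw [← hju a, ← hju b, dist_eq_norm]
  have h1 := hℓ (u a - u b)
  have h2 : ‖u a - u b‖ < 2 := by
    have h3 := norm_sub_le (u a) (u b)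
    have h4 := mem_ball_zero_iff.1 (hu a)
    have h5 := mem_ball_zero_iff.1 (hu b)
    linarith
  have h6 : ‖ℓ (u a - u b)‖ < ε / 2 := by
    rw [map_sub, ← dist_eq_norm]
    have h3 := hyb a
    have h4 := hyb b
    rw [hab', Metric.mem_ball] at h3
    rw [Metric.mem_ball, dist_comm] at h4
    linarith [dist_triangle (ℓ (u a)) (y b) (ℓ (u b))]
  have h7 : ‖j (u a) - j (u b)‖ = ‖j (u a - u b)‖ := by rw [map_sub]
  show ‖j (u a) - j (u b)‖ < ε
  nlinarith

/-- `u ↦ u` as a map `H¹₀ → L²`. -/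
def valH10 (Ω : Opens Plane) : H10 Ω →L[ℝ] L2 Ω ℝ := valCLM Ω ∘L (H10 Ω).subtypeL

@[simp] lemma valH10_apply {Ω : Opens Plane} (u : H10 Ω) : valH10 Ω u = H1.val u.1 := rfl

/-- Rellich's theorem for `H¹₀` of a bounded open set. -/
theorem isCompactOperator_valH10 {Ω : Opens Plane} (hΩ : Bornology.IsBounded (Ω : Set Plane)) :
    IsCompactOperator (valH10 Ω) := by
  refine isCompactOperator_of_finite_functionals (H := H10 Ω) _ fun δ hδ => ?_
  obtain ⟨ι, _, ℓ, hℓ⟩ := exists_finite_functionals hΩ (δ := δ ^ 2) (by positivity)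
  refine ⟨ι, inferInstance, ℓ ∘L valH10 Ω, fun u => ?_⟩
  have h1 := hℓ u u.2
  have h2 := norm_sq_H1 (u : H1 Ω)
  refine abs_le_of_sq_le_sq' ?_ (by positivity) |>.2
  show ‖H1.val (u : H1 Ω)‖ ^ 2 ≤ (δ * ‖(u : H1 Ω)‖ + ‖ℓ (H1.val (u : H1 Ω))‖) ^ 2
  have h3 : 0 ≤ δ * ‖(u : H1 Ω)‖ * ‖ℓ (H1.val (u : H1 Ω))‖ := by positivity
  have h4 : δ ^ 2 * ‖H1.grad (u : H1 Ω)‖ ^ 2 ≤ δ ^ 2 * ‖(u : H1 Ω)‖ ^ 2 := by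
    gcongr
    nlinarith [sq_nonneg ‖H1.val (u : H1 Ω)‖, norm_nonneg (u : H1 Ω),
      norm_nonneg (H1.grad (u : H1 Ω))]
  nlinarith

end Compactness

variable {Ω : Opens Plane}

section Fredholm

lemma inner_H1 (u v : H1 Ω) :
    inner ℝ u v = inner ℝ (H1.val u) (H1.val v) + inner ℝ (H1.grad u) (H1.grad v) :=
  WithLp.prod_inner_apply u.1 v.1

lemma norm_val_le (u : H1 Ω) : ‖H1.val u‖ ≤ ‖u‖ :=
  abs_le_of_sq_le_sq' (by nlinarith [norm_sq_H1 u, sq_nonneg ‖H1.grad u‖]) (norm_nonneg _) |>.2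

lemma norm_grad_le (u : H1 Ω) : ‖H1.grad u‖ ≤ ‖u‖ :=
  abs_le_of_sq_le_sq' (by nlinarith [norm_sq_H1 u, sq_nonneg ‖H1.val u‖]) (norm_nonneg _) |>.2

/-- The Dirichlet form `α ∫ ∇u·∇v + β ∫ u v`. -/
def dirichletForm (α β : ℝ) (u v : H1 Ω) : ℝ :=
  α * inner ℝ (H1.grad u) (H1.grad v) + β * inner ℝ (H1.val u) (H1.val v)

/-- The Fredholm alternative for a compact perturbation `α ⟪u, v⟫ + γ ⟪j u, j v⟫` of the inner
product: injectivity implies unique solvability. -/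
theorem fredholm_alternative {H G : Type} [NormedAddCommGroup H] [InnerProductSpace ℝ H]
    [CompleteSpace H] [NormedAddCommGroup G] [InnerProductSpace ℝ G] [CompleteSpace G]
    {j : H →L[ℝ] G} (hj : IsCompactOperator j) {α γ : ℝ} (hα : 0 < α)
    (hinj : ∀ u : H, (∀ v : H, α * inner ℝ u v + γ * inner ℝ (j u) (j v) = 0) → u = 0) :
    ∃ C : ℝ, 0 < C ∧
      (∀ (u : H) (σ : ℝ), 0 ≤ σ →
        (∀ v : H, |α * inner ℝ u v + γ * inner ℝ (j u) (j v)| ≤ σ * ‖v‖) → ‖u‖ ≤ C * σ) ∧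
      ∀ L : H →L[ℝ] ℝ, ∃ u : H, ∀ v : H, α * inner ℝ u v + γ * inner ℝ (j u) (j v) = L v := by
  set S : H →L[ℝ] H := (-γ / α) • (ContinuousLinearMap.adjoint j ∘L j) with hS
  have hcomp : IsCompactOperator S := (hj.clm_comp (ContinuousLinearMap.adjoint j)).smul (-γ / α)
  have hform : ∀ u v : H,
      α * inner ℝ u v + γ * inner ℝ (j u) (j v) = α * inner ℝ (u - S u) v := by
    intro u v
    have h1 : inner ℝ (S u) v = -γ / α * inner ℝ (j u) (j v) := by
      rw [hS, smul_apply, real_inner_smul_left,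
        ContinuousLinearMap.comp_apply, ContinuousLinearMap.adjoint_inner_left]
    rw [inner_sub_left, h1]
    field_simp
    ring
  simp only [hform] at hinj ⊢
  have hne : ¬ Module.End.HasEigenvalue (S : Module.End ℝ H) 1 := by
    intro h
    obtain ⟨u, hu⟩ := h.exists_hasEigenvector
    refine hu.2 (hinj u fun v => ?_)
    have h1 : S u = u := by simpa using hu.apply_eq_smul
    rw [h1, sub_self, inner_zero_left, mul_zero]
  have hunit := (hcomp.hasEigenvalue_or_mem_resolventSet one_ne_zero).resolve_left hne
  rw [spectrum.mem_resolventSet_iff, map_one] at hunit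
  obtain ⟨w, hw⟩ := hunit
  have hwu : ∀ u, u - S u = w.1 u := fun u => by rw [hw]; rfl
  obtain ⟨T, hT, hT'⟩ : ∃ T : H →L[ℝ] H, (∀ u, T (w.1 u) = u) ∧ ∀ u, w.1 (T u) = u :=
    ⟨(w⁻¹).1, fun u => DFunLike.congr_fun w.inv_mul u, fun u => DFunLike.congr_fun w.mul_inv u⟩
  simp only [hwu]
  refine ⟨‖T‖ / α + 1, by positivity, fun u σ hσ h => ?_, fun L => ?_⟩
  · have h1 : α * ‖w.1 u‖ ≤ σ := by
      by_cases h0 : ‖w.1 u‖ = 0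
      · rw [h0, mul_zero]
        exact hσ
      · have h2 := (le_abs_self _).trans (h (w.1 u))
        rw [real_inner_self_eq_norm_sq] at h2
        have h3 : 0 < ‖w.1 u‖ := lt_of_le_of_ne (norm_nonneg _) (Ne.symm h0)
        refine le_of_mul_le_mul_right ?_ h3
        linarith
    have h2 : ‖u‖ ≤ ‖T‖ * ‖w.1 u‖ := by
      conv_lhs => rw [← hT u]
      exact T.le_opNorm _
    have h3 : ‖w.1 u‖ ≤ σ / α := by rw [le_div_iff₀ hα]; linarith
    calc ‖u‖ ≤ ‖T‖ * (σ / α) := h2.trans (by gcongr)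
      _ = ‖T‖ / α * σ := by ring
      _ ≤ _ := by linarith
  · refine ⟨T (α⁻¹ • (InnerProductSpace.toDual ℝ H).symm L), fun v => ?_⟩
    rw [hT', real_inner_smul_left, InnerProductSpace.toDual_symm_apply,
      mul_inv_cancel_left₀ hα.ne']

/-- The Fredholm alternative for the Dirichlet form. -/
theorem dirichletForm_alternative (hΩ : Bornology.IsBounded (Ω : Set Plane)) {α β : ℝ}
    (hα : 0 < α)
    (hinj : ∀ u : H10 Ω, (∀ v : H10 Ω, dirichletForm α β u.1 v.1 = 0) → u = 0) :
    ∃ C : ℝ, 0 < C ∧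
      (∀ (u : H10 Ω) (σ : ℝ), 0 ≤ σ → (∀ v : H10 Ω, |dirichletForm α β u.1 v.1| ≤ σ * ‖v‖) →
        ‖u‖ ≤ C * σ) ∧
      ∀ L : H10 Ω →L[ℝ] ℝ, ∃ u : H10 Ω, ∀ v : H10 Ω, dirichletForm α β u.1 v.1 = L v := by
  have hform : ∀ u v : H10 Ω, dirichletForm α β u.1 v.1 = α * inner ℝ u v +
      (β - α) * inner ℝ (valH10 Ω u) (valH10 Ω v) := by
    intro u v
    have h : inner ℝ u v =
        inner ℝ (H1.val u.1) (H1.val v.1) + inner ℝ (H1.grad u.1) (H1.grad v.1) :=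
      inner_H1 u.1 v.1
    rw [h, dirichletForm, valH10_apply, valH10_apply]
    ring
  simp only [hform] at hinj ⊢
  have hc := isCompactOperator_valH10 hΩ
  have key := @fredholm_alternative (H10 Ω) (L2 Ω ℝ) _ _ _ _ _ _ (valH10 Ω)
  exact key hc hα hinj

theorem exists_poisson (hΩ : Bornology.IsBounded (Ω : Set Plane)) :
    ∃ C : ℝ, 0 < C ∧
      (∀ (u : H10 Ω) (σ : ℝ), 0 ≤ σ → (∀ v : H10 Ω, |dirichletForm 1 0 u.1 v.1| ≤ σ * ‖v‖) →
        ‖u‖ ≤ C * σ) ∧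
      ∀ L : H10 Ω →L[ℝ] ℝ, ∃ u : H10 Ω, ∀ v : H10 Ω, dirichletForm 1 0 u.1 v.1 = L v := by
  refine dirichletForm_alternative hΩ one_pos fun u hu => ?_
  obtain ⟨C, -, hC⟩ := exists_poincare hΩ
  have h1 := hu u
  rw [dirichletForm, one_mul, zero_mul, add_zero, real_inner_self_eq_norm_sq] at h1
  have h2 : ‖H1.grad u.1‖ = 0 := by simpa using h1
  have h3 := hC u.1 u.2
  rw [h2, mul_zero] at h3
  refine Subtype.ext (H1.val_injective ?_)
  exact norm_le_zero_iff.1 h3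

theorem exists_helmholtz (hΩ : Bornology.IsBounded (Ω : Set Plane)) {lam : ℝ} (hlam : 0 < lam)
    (hker : ∀ μ : ℝ, IsDirichletEigenvalue Ω μ → lam * μ ≠ 1) :
    ∃ C : ℝ, 0 < C ∧
      (∀ (u : H10 Ω) (σ : ℝ), 0 ≤ σ → (∀ v : H10 Ω, |dirichletForm lam (-1) u.1 v.1| ≤ σ * ‖v‖) →
        ‖u‖ ≤ C * σ) ∧
      ∀ L : H10 Ω →L[ℝ] ℝ, ∃ u : H10 Ω, ∀ v : H10 Ω, dirichletForm lam (-1) u.1 v.1 = L v := by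
  refine dirichletForm_alternative hΩ hlam fun u hu => ?_
  by_contra hne
  refine hker lam⁻¹ ⟨u.1, u.2, fun h => hne (Subtype.ext h), fun v hv => ?_⟩
    (mul_inv_cancel₀ hlam.ne')
  have h1 := hu ⟨v, hv⟩
  rw [dirichletForm] at h1
  rw [inv_mul_eq_div, eq_div_iff hlam.ne']
  linarith

end Fredholm

section System

lemma Hdiv.inner_add_eq_zero (r : Hdiv Ω) {v : H1 Ω} (hv : v ∈ H10 Ω) :
    inner ℝ (Hdiv.val r) (H1.grad v) + inner ℝ (Hdiv.div r) (H1.val v) = 0 :=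
  green_eq_zero_of_mem_H10 r hv

lemma mem_Hdiv_of_inner {R : L2 Ω Plane} {d : L2 Ω ℝ}
    (h : ∀ φ : 𝓓(Ω, ℝ),
      inner ℝ R (H1.grad (testH1 φ)) + inner ℝ d (H1.val (testH1 φ)) = 0) :
    WithLp.toLp 2 (R, d) ∈ Hdiv Ω := by
  intro φ
  have e1 : inner ℝ R (H1.grad (testH1 φ)) = ∫ x in (Ω : Set Plane), inner ℝ (R x) (∇ φ x) := by
    rw [L2.inner_def]
    refine integral_congr_ae ?_
    filter_upwards [coeFn_grad_testH1 φ] with x hx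
    rw [hx]
  have e2 : inner ℝ d (H1.val (testH1 φ)) = ∫ x in (Ω : Set Plane), φ x * d x := by
    rw [L2.inner_def]
    refine integral_congr_ae ?_
    filter_upwards [coeFn_val_testH1 φ] with x hx
    rw [hx]
    simp
  have := h φ
  rw [e1, e2] at this
  exact eq_neg_of_add_eq_zero_left this

/-- Residual of `-u - lam div r - q = 0`. -/
def potentialResidual (lam : ℝ) (U : Trial Ω) : L2 Ω ℝ :=
  -(H1.val U.u.1 + H1.val U.q.1) - lam • Hdiv.div U.r

/-- The first-order system is solvable for arbitrary square integrable data. -/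
theorem exists_trial (hΩ : Bornology.IsBounded (Ω : Set Plane)) {lam D : ℝ} (hlam : 0 < lam)
    (hD : 0 < D) (hker : ∀ μ : ℝ, IsDirichletEigenvalue Ω μ → lam * μ ≠ 1)
    (g₁ g₂ : L2 Ω Plane) (g₃ g₄ : L2 Ω ℝ) :
    ∃ U : Trial Ω, H1.grad U.u.1 - Hdiv.val U.r = g₁ ∧ H1.grad U.q.1 - Hdiv.val U.t = g₂ ∧
      potentialResidual lam U = g₃ ∧ -D • Hdiv.div U.t = g₄ := by
  obtain ⟨-, -, -, hp⟩ := exists_poisson hΩ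
  obtain ⟨-, -, -, hh⟩ := exists_helmholtz hΩ hlam hker
  obtain ⟨q, hq⟩ := hp ((innerSL ℝ g₂ ∘L gradCLM Ω + D⁻¹ • innerSL ℝ g₄ ∘L valCLM Ω) ∘L
    (H10 Ω).subtypeL)
  obtain ⟨u, hu⟩ := hh ((lam • innerSL ℝ g₁ ∘L gradCLM Ω +
    innerSL ℝ (g₃ + H1.val q.1) ∘L valCLM Ω) ∘L (H10 Ω).subtypeL)
  have hq' : ∀ v ∈ H10 Ω, inner ℝ (H1.grad q.1) (H1.grad v) =
      inner ℝ g₂ (H1.grad v) + D⁻¹ * inner ℝ g₄ (H1.val v) := fun v hv => by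
    have := hq ⟨v, hv⟩
    rw [dirichletForm, one_mul, zero_mul, add_zero] at this
    exact this
  have hu' : ∀ v ∈ H10 Ω, lam * inner ℝ (H1.grad u.1) (H1.grad v) +
      -1 * inner ℝ (H1.val u.1) (H1.val v) =
      lam * inner ℝ g₁ (H1.grad v) + inner ℝ (g₃ + H1.val q.1) (H1.val v) := fun v hv =>
    hu ⟨v, hv⟩
  have ht : WithLp.toLp 2 (H1.grad q.1 - g₂, -D⁻¹ • g₄) ∈ Hdiv Ω :=
    mem_Hdiv_of_inner fun φ => by
      rw [inner_sub_left, hq' _ (testH1_mem_H10 φ), real_inner_smul_left]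
      ring
  have hr : WithLp.toLp 2 (H1.grad u.1 - g₁, -lam⁻¹ • (g₃ + H1.val u.1 + H1.val q.1)) ∈ Hdiv Ω :=
    mem_Hdiv_of_inner fun φ => by
      have := hu' _ (testH1_mem_H10 φ)
      rw [inner_add_left] at this
      rw [inner_sub_left, real_inner_smul_left, inner_add_left, inner_add_left]
      field_simp
      linarith
  refine ⟨⟨u, q, ⟨_, hr⟩, ⟨_, ht⟩⟩, ?_, ?_, ?_, ?_⟩
  · show H1.grad u.1 - (H1.grad u.1 - g₁) = g₁
    abel
  · show H1.grad q.1 - (H1.grad q.1 - g₂) = g₂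
    abel
  · show -(H1.val u.1 + H1.val q.1) - lam • (-lam⁻¹ • (g₃ + H1.val u.1 + H1.val q.1)) = g₃
    rw [smul_smul, mul_neg, mul_inv_cancel₀ hlam.ne']
    module
  · show -D • (-D⁻¹ • g₄) = g₄
    rw [smul_smul, neg_mul_neg, mul_inv_cancel₀ hD.ne', one_smul]

lemma abs_inner_grad_sub_le {u v : H1 Ω} {R : L2 Ω Plane} {σ : ℝ} (hσ : 0 ≤ σ)
    (h : ‖H1.grad u - R‖ ≤ σ) :
    |inner ℝ (H1.grad u) (H1.grad v) - inner ℝ R (H1.grad v)| ≤ σ * ‖v‖ := by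
  rw [← inner_sub_left]
  exact (abs_real_inner_le_norm _ _).trans
    (mul_le_mul h (norm_grad_le v) (norm_nonneg _) hσ)

lemma abs_dirichletForm_le_of_flux {D σ : ℝ} (hD : 0 < D) (hσ : 0 ≤ σ) {q w : H1 Ω} {t : Hdiv Ω}
    (hw : w ∈ H10 Ω) (h : ‖H1.grad q - Hdiv.val t‖ ≤ σ)
    (h' : |inner ℝ (-D • Hdiv.div t) (H1.val w)| ≤ σ * ‖w‖) :
    |dirichletForm 1 0 q w| ≤ (D⁻¹ + 1) * σ * ‖w‖ := by
  have e1 := Hdiv.inner_add_eq_zero t hw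
  have e3 := abs_inner_grad_sub_le (v := w) hσ h
  rw [real_inner_smul_left] at h'
  rw [dirichletForm]
  generalize inner ℝ (H1.grad q) (H1.grad w) = x at *
  generalize inner ℝ (Hdiv.val t) (H1.grad w) = y at *
  generalize inner ℝ (Hdiv.div t) (H1.val w) = z at *
  generalize inner ℝ (H1.val q) (H1.val w) = k at *
  generalize ‖w‖ = n at *
  have e5 : 1 * x + 0 * k = (x - y) + D⁻¹ * (-D * z) := by
    have : D⁻¹ * (-D * z) = -z := by field_simp
    rw [this]
    linarith
  rw [e5]
  refine (abs_add_le _ _).trans ?_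
  rw [abs_mul, abs_of_pos (inv_pos.2 hD)]
  have e6 := mul_le_mul_of_nonneg_left h' (inv_pos.2 hD).le
  linarith

lemma abs_dirichletForm_le_of_potential {lam σ a : ℝ} (hlam : 0 < lam) (hσ : 0 ≤ σ)
    {U : Trial Ω} {v : H1 Ω} (hv : v ∈ H10 Ω) (ha : ‖U.q‖ ≤ a)
    (h : ‖H1.grad U.u.1 - Hdiv.val U.r‖ ≤ σ)
    (h' : |inner ℝ (potentialResidual lam U) (H1.val v)| ≤ σ * ‖v‖) :
    |dirichletForm lam (-1) U.u.1 v| ≤ (σ + a + lam * σ) * ‖v‖ := by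
  have e1 := Hdiv.inner_add_eq_zero U.r hv
  have e3 := abs_inner_grad_sub_le (v := v) hσ h
  have e5 : |inner ℝ (H1.val U.q.1) (H1.val v)| ≤ a * ‖v‖ :=
    (abs_real_inner_le_norm _ _).trans
      (mul_le_mul ((norm_val_le U.q.1).trans ha) (norm_val_le v) (norm_nonneg _)
        ((norm_nonneg _).trans ha))
  rw [potentialResidual, inner_sub_left, inner_neg_left, inner_add_left,
    real_inner_smul_left] at h'
  rw [dirichletForm]
  generalize inner ℝ (H1.grad U.u.1) (H1.grad v) = x at *
  generalize inner ℝ (Hdiv.val U.r) (H1.grad v) = y at *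
  generalize inner ℝ (Hdiv.div U.r) (H1.val v) = z at *
  generalize inner ℝ (H1.val U.u.1) (H1.val v) = k at *
  generalize inner ℝ (H1.val U.q.1) (H1.val v) = l at *
  generalize ‖v‖ = n at *
  have e10 : lam * x + -1 * k = (-(k + l) - lam * z) + l + lam * (x - y) := by
    linear_combination lam * e1
  rw [e10]
  have e8 : |lam * (x - y)| ≤ lam * (σ * n) := by
    rw [abs_mul, abs_of_pos hlam]
    exact mul_le_mul_of_nonneg_left e3 hlam.le
  have e11 := abs_add_le (-(k + l) - lam * z + l) (lam * (x - y))
  have e12 := abs_add_le (-(k + l) - lam * z) l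
  linarith

lemma norm_flux_le {u : H1 Ω} {R : L2 Ω Plane} {a σ : ℝ} (hu : ‖u‖ ≤ a)
    (h : ‖H1.grad u - R‖ ≤ σ) : ‖R‖ ≤ a + σ := by
  have h1 := norm_sub_le (H1.grad u) (H1.grad u - R)
  rw [sub_sub_cancel] at h1
  have h2 := norm_grad_le u
  linarith

/-- Stability of the fields, with the scalar residuals measured in the dual of `H¹₀`. -/
theorem exists_field_bound (hΩ : Bornology.IsBounded (Ω : Set Plane)) {lam D : ℝ} (hlam : 0 < lam)
    (hD : 0 < D) (hker : ∀ μ : ℝ, IsDirichletEigenvalue Ω μ → lam * μ ≠ 1) :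
    ∃ C : ℝ, 0 < C ∧ ∀ (U : Trial Ω) (σ : ℝ), 0 ≤ σ →
      ‖H1.grad U.u.1 - Hdiv.val U.r‖ ≤ σ → ‖H1.grad U.q.1 - Hdiv.val U.t‖ ≤ σ →
      (∀ v ∈ H10 Ω, |inner ℝ (potentialResidual lam U) (H1.val v)| ≤ σ * ‖v‖) →
      (∀ w ∈ H10 Ω, |inner ℝ (-D • Hdiv.div U.t) (H1.val w)| ≤ σ * ‖w‖) →
      ‖U.u‖ ≤ C * σ ∧ ‖U.q‖ ≤ C * σ ∧ ‖Hdiv.val U.r‖ ≤ C * σ ∧ ‖Hdiv.val U.t‖ ≤ C * σ := by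
  obtain ⟨C₁, hC₁, hp, -⟩ := exists_poisson hΩ
  obtain ⟨C₂, hC₂, hh, -⟩ := exists_helmholtz hΩ hlam hker
  set a := C₁ * (D⁻¹ + 1) with ha
  set b := C₂ * (1 + a + lam) with hb
  have ha0 : 0 < a := by positivity
  have hb0 : 0 < b := by positivity
  refine ⟨a + b + 1, by positivity, fun U σ hσ h₁ h₂ h₃ h₄ => ?_⟩
  have hq : ‖U.q‖ ≤ a * σ := by
    rw [ha, mul_assoc]
    exact hp U.q _ (by positivity) fun w => abs_dirichletForm_le_of_flux hD hσ w.2 h₂ (h₄ w.1 w.2)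
  have hu : ‖U.u‖ ≤ b * σ := by
    rw [hb, mul_assoc]
    refine hh U.u _ (by positivity) fun v => ?_
    refine (abs_dirichletForm_le_of_potential hlam hσ v.2 hq h₁ (h₃ v.1 v.2)).trans_eq ?_
    show _ = _ * ‖(v : H1 Ω)‖
    ring
  have hr := norm_flux_le (u := U.u.1) hu h₁
  have ht := norm_flux_le (u := U.q.1) hq h₂
  have h1 : 0 ≤ a * σ := by positivity
  have h2 : 0 ≤ b * σ := by positivity
  have e : (a + b + 1) * σ = a * σ + b * σ + σ := by ring
  rw [e]
  exact ⟨by linarith, by linarith, by linarith, by linarith⟩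

end System

section PartitionSums

variable {K Ω : Opens Plane} {n : ℕ} (P : Partition Ω n) {F : Type} [NormedAddCommGroup F]

lemma Partition.ae_eq_iUnion :
    (Ω : Set Plane) =ᵐ[volume] ⋃ m, (P.elem m : Set Plane) := by
  refine ae_eq_set.2 ⟨?_, ?_⟩
  · refine measure_mono_null (t := ⋃ m, frontier (P.elem m : Set Plane)) ?_
      (measure_iUnion_null P.null_frontier)
    rintro x ⟨hx, hx'⟩
    rw [P.eq_interior] at hx
    obtain ⟨m, hm⟩ := Set.mem_iUnion.1 (interior_subset hx)
    refine Set.mem_iUnion.2 ⟨m, hm, fun hi => hx' ?_⟩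
    rw [(P.elem m).isOpen.interior_eq] at hi
    exact Set.mem_iUnion.2 ⟨m, hi⟩
  · rw [Set.sdiff_eq_empty.2 (Set.iUnion_subset fun m => P.le m), measure_empty]

variable [InnerProductSpace ℝ F]

lemma Partition.inner_eq_sum (f g : L2 Ω F) :
    inner ℝ f g = ∑ m, inner ℝ (restrictL2 (P.le m) f) (restrictL2 (P.le m) g) := by
  have hi : Integrable (fun x => inner ℝ (f x) (g x)) (volume.restrict (Ω : Set Plane)) :=
    L2.integrable_inner (𝕜 := ℝ) f g
  rw [L2.inner_def, setIntegral_congr_set P.ae_eq_iUnion,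
    integral_iUnion_fintype (fun m => (P.elem m).isOpen.measurableSet) P.disjoint
      (fun m => IntegrableOn.mono_set hi (P.le m))]
  refine Finset.sum_congr rfl fun m _ => ?_
  rw [L2.inner_def]
  refine integral_congr_ae ?_
  filter_upwards [coeFn_restrictL2 (P.le m) f, coeFn_restrictL2 (P.le m) g] with x h1 h2
  rw [h1, h2]

lemma Partition.norm_sq_eq_sum (f : L2 Ω F) :
    ‖f‖ ^ 2 = ∑ m, ‖restrictL2 (P.le m) f‖ ^ 2 := by
  rw [← real_inner_self_eq_norm_sq, P.inner_eq_sum]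
  exact Finset.sum_congr rfl fun m _ => real_inner_self_eq_norm_sq _

lemma norm_restrictL2_le (h : K ≤ Ω) (f : L2 Ω F) : ‖restrictL2 h f‖ ≤ ‖f‖ := by
  rw [← enorm_le_iff_norm_le, Lp.enorm_def, Lp.enorm_def,
    eLpNorm_congr_ae (coeFn_restrictL2 h f)]
  exact eLpNorm_mono_measure _ (Measure.restrict_mono h le_rfl)

lemma continuous_restrictL2 (h : K ≤ Ω) : Continuous (restrictL2 h : L2 Ω F →ₗ[ℝ] L2 K F) :=
  ((restrictL2 h).mkContinuous 1 fun f => by simpa using norm_restrictL2_le h f).continuous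

/-- Extension by zero of a square integrable function on one element. -/
lemma Partition.exists_extension (m : Fin n) (f : L2 (P.elem m) F) :
    ∃ g : L2 Ω F, restrictL2 (P.le m) g = f ∧ ∀ k, k ≠ m → restrictL2 (P.le k) g = 0 := by
  have hm : MeasurableSet (P.elem m : Set Plane) := (P.elem m).isOpen.measurableSet
  have hg : MemLp ((P.elem m : Set Plane).indicator f) 2 (volume.restrict (Ω : Set Plane)) := by
    rw [memLp_indicator_iff_restrict hm, Measure.restrict_restrict hm,
      Set.inter_eq_left.2 (P.le m)]
    exact Lp.memLp f
  refine ⟨hg.toLp _, Lp.ext ?_, fun k hk => Lp.ext ?_⟩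
  · have h2 := ae_mono (Measure.restrict_mono (P.le m) le_rfl) hg.coeFn_toLp
    filter_upwards [coeFn_restrictL2 (P.le m) (hg.toLp _), h2, ae_restrict_mem hm] with x h1 h2 h3
    rw [h1, h2, Set.indicator_of_mem h3]
  · have h2 := ae_mono (Measure.restrict_mono (P.le k) le_rfl) hg.coeFn_toLp
    filter_upwards [coeFn_restrictL2 (P.le k) (hg.toLp _), h2,
      ae_restrict_mem (P.elem k).isOpen.measurableSet,
      Lp.coeFn_zero F 2 (volume.restrict (P.elem k : Set Plane))] with x h1 h2 h3 h4
    rw [h1, h2, h4, Set.indicator_of_notMem (Set.disjoint_left.1 (P.disjoint hk) h3)]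
    rfl

end PartitionSums

section BrokenSpaces

variable {K Ω : Opens Plane} {n : ℕ} {P : Partition Ω n}

lemma restrictPair_mem_H1 (h : K ≤ Ω) (u : H1 Ω) : restrictPair h u.1 ∈ H1 K := by
  intro φ
  have hu := u.2 (extendTest h φ)
  have h1 : ∫ x in (K : Set Plane), (restrictPair h u.1).fst x • ∇ φ x =
      ∫ x in (Ω : Set Plane), u.1.fst x • ∇ (extendTest h φ) x := by
    rw [setIntegral_eq_of_subset_of_forall_sdiff_eq_zero (s := (K : Set Plane))
      Ω.isOpen.measurableSet h]
    · refine integral_congr_ae ?_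
      filter_upwards [coeFn_restrictL2 h u.1.fst] with x hx
      exact congrArg (fun y => y • ∇ φ x) hx
    · intro x hx
      exact (congrArg _ (gradient_eq_zero_of_notMem φ hx.2)).trans (smul_zero _)
  have h2 : ∫ x in (K : Set Plane), φ x • (restrictPair h u.1).snd x =
      ∫ x in (Ω : Set Plane), extendTest h φ x • u.1.snd x := by
    rw [setIntegral_eq_of_subset_of_forall_sdiff_eq_zero (s := (K : Set Plane))
      Ω.isOpen.measurableSet h]
    · refine integral_congr_ae ?_
      filter_upwards [coeFn_restrictL2 h u.1.snd] with x hx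
      exact congrArg (fun y => φ x • y) hx
    · intro x hx
      exact (congrArg (· • u.1.snd x) (testFunction_eq_zero φ hx.2)).trans (zero_smul ℝ _)
  rw [h1, h2, hu]

/-- An `H¹` function as a broken `H¹` function. -/
def H1.toBroken (P : Partition Ω n) (u : H1 Ω) : BrokenH1 P :=
  ⟨u.1, fun m => restrictPair_mem_H1 (P.le m) u⟩

lemma continuous_restrictPair (h : K ≤ Ω) :
    Continuous (restrictPair h : WithLp 2 (L2 Ω ℝ × L2 Ω Plane) →ₗ[ℝ] _) := by
  refine (WithLp.prod_continuous_toLp 2 _ _).comp (Continuous.prodMk ?_ ?_)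
  · exact (continuous_restrictL2 h).comp (WithLp.prod_continuous_ofLp 2 _ _).fst
  · exact (continuous_restrictL2 h).comp (WithLp.prod_continuous_ofLp 2 _ _).snd

lemma mem_BrokenH1_iff {p : WithLp 2 (L2 Ω ℝ × L2 Ω Plane)} :
    p ∈ BrokenH1 P ↔ ∀ m, restrictPair (P.le m) p ∈ H1 (P.elem m) := Iff.rfl

lemma isClosed_BrokenH1 :
    IsClosed (BrokenH1 P : Set (WithLp 2 (L2 Ω ℝ × L2 Ω Plane))) := by
  refine isClosed_of_closure_subset fun p hp => mem_BrokenH1_iff.2 fun m => ?_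
  refine isClosed_H1.closure_subset (map_mem_closure (continuous_restrictPair (P.le m)) hp ?_)
  exact fun q hq => mem_BrokenH1_iff.1 hq m

instance : CompleteSpace (BrokenH1 P) := isClosed_BrokenH1.completeSpace_coe

lemma BrokenH1.norm_sq (v : BrokenH1 P) :
    ‖v‖ ^ 2 = ‖BrokenH1.val v‖ ^ 2 + ‖BrokenH1.grad v‖ ^ 2 :=
  WithLp.prod_norm_sq_eq_of_L2 _

lemma Hdiv.norm_sq (r : Hdiv Ω) : ‖r‖ ^ 2 = ‖Hdiv.val r‖ ^ 2 + ‖Hdiv.div r‖ ^ 2 :=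
  WithLp.prod_norm_sq_eq_of_L2 _

lemma BrokenH1.val_restrict (v : BrokenH1 P) (m : Fin n) :
    H1.val (BrokenH1.restrict v m) = restrictL2 (P.le m) (BrokenH1.val v) := rfl

lemma BrokenH1.grad_restrict (v : BrokenH1 P) (m : Fin n) :
    H1.grad (BrokenH1.restrict v m) = restrictL2 (P.le m) (BrokenH1.grad v) := rfl

lemma BrokenH1.eq_zero_of_val_eq_zero {v : BrokenH1 P} (h : BrokenH1.val v = 0) : v = 0 := by
  have h1 : ∀ m, BrokenH1.restrict v m = 0 := fun m => H1.val_injective <| by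
    rw [BrokenH1.val_restrict, h, map_zero]
    rfl
  have h2 : ‖BrokenH1.grad v‖ ^ 2 = 0 := by
    rw [P.norm_sq_eq_sum]
    refine Finset.sum_eq_zero fun m _ => ?_
    rw [← BrokenH1.grad_restrict, h1 m]
    have : H1.grad (0 : H1 (P.elem m)) = 0 := rfl
    rw [this, norm_zero, zero_pow two_ne_zero]
  have h3 := BrokenH1.norm_sq v
  rw [h2, h, norm_zero] at h3
  exact norm_eq_zero.1 (by simpa using h3)

end BrokenSpaces

section Skeleton

variable {K Ω : Opens Plane} {n : ℕ} (P : Partition Ω n)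

/-- Green's formula summed over the elements. -/
lemma sum_normalTrace (r : Hdiv Ω) (v : BrokenH1 P) :
    ∑ m, normalTrace (Hdiv.restrict (P.le m) r) (trace (BrokenH1.restrict v m)) =
      inner ℝ (Hdiv.val r) (BrokenH1.grad v) + inner ℝ (Hdiv.div r) (BrokenH1.val v) := by
  rw [P.inner_eq_sum, P.inner_eq_sum (Hdiv.div r), ← Finset.sum_add_distrib]
  rfl

/-- Extension by zero of an `H¹` function on one element, tested with Green's form. -/
lemma exists_broken_extension (m : Fin n) (v : H1 (P.elem m)) :
    ∃ e : BrokenH1 P, ∀ r : Hdiv Ω,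
      inner ℝ (Hdiv.val r) (BrokenH1.grad e) + inner ℝ (Hdiv.div r) (BrokenH1.val e) =
        normalTrace (Hdiv.restrict (P.le m) r) (trace v) := by
  obtain ⟨f, hf, hf'⟩ := P.exists_extension m (H1.val v)
  obtain ⟨g, hg, hg'⟩ := P.exists_extension m (H1.grad v)
  have hm : restrictPair (P.le m) (WithLp.toLp 2 (f, g)) = v.1 :=
    WithLp.ofLp_injective 2 (Prod.ext hf hg)
  have hk : ∀ k, k ≠ m → restrictPair (P.le k) (WithLp.toLp 2 (f, g)) = 0 := fun k hk =>
    WithLp.ofLp_injective 2 (Prod.ext (hf' k hk) (hg' k hk))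
  have he : WithLp.toLp 2 (f, g) ∈ BrokenH1 P := fun k => by
    by_cases h : k = m
    · subst h
      rw [hm]
      exact v.2
    · rw [hk k h]
      exact (H1 (P.elem k)).zero_mem
  refine ⟨⟨_, he⟩, fun r => ?_⟩
  rw [← sum_normalTrace, Finset.sum_eq_single m]
  · congr 2
    exact Subtype.ext hm
  · intro k _ h
    have : BrokenH1.restrict (⟨_, he⟩ : BrokenH1 P) k = 0 := Subtype.ext (hk k h)
    rw [this, map_zero, map_zero]
  · simp

/-- The extension of minimal energy of normal traces is the broken gradient of the Riesz
representative of the traces. -/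
theorem exists_minimal_extension (r : Hdiv Ω) :
    ∃ (R : Hdiv Ω) (z : BrokenH1 P),
      (∀ m, normalTrace (Hdiv.restrict (P.le m) R) = normalTrace (Hdiv.restrict (P.le m) r)) ∧
      ‖R‖ = ‖z‖ ∧
      inner ℝ (Hdiv.val r) (BrokenH1.grad z) + inner ℝ (Hdiv.div r) (BrokenH1.val z) =
        ‖z‖ ^ 2 := by
  obtain ⟨z, hz⟩ : ∃ z : BrokenH1 P, ∀ w : BrokenH1 P,
      inner ℝ (BrokenH1.grad z) (BrokenH1.grad w) + inner ℝ (BrokenH1.val z) (BrokenH1.val w) =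
        inner ℝ (Hdiv.val r) (BrokenH1.grad w) + inner ℝ (Hdiv.div r) (BrokenH1.val w) := by
    set p : WithLp 2 (L2 Ω ℝ × L2 Ω Plane) := WithLp.toLp 2 (Hdiv.div r, Hdiv.val r)
    refine ⟨(BrokenH1 P).orthogonalProjectionOnto p, fun w => ?_⟩
    have h := Submodule.inner_orthogonalProjectionOnto_eq_of_mem_left w p
    have h1 : inner ℝ ((BrokenH1 P).orthogonalProjectionOnto p) w =
        inner ℝ (BrokenH1.val ((BrokenH1 P).orthogonalProjectionOnto p)) (BrokenH1.val w) +
        inner ℝ (BrokenH1.grad ((BrokenH1 P).orthogonalProjectionOnto p)) (BrokenH1.grad w) :=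
      WithLp.prod_inner_apply _ _
    have h2 : inner ℝ (w : WithLp 2 (L2 Ω ℝ × L2 Ω Plane)) p =
        inner ℝ (BrokenH1.val w) (Hdiv.div r) + inner ℝ (BrokenH1.grad w) (Hdiv.val r) :=
      WithLp.prod_inner_apply _ _
    rw [real_inner_comm] at h
    rw [h1, h2] at h
    have k1 := real_inner_comm (BrokenH1.val w) (Hdiv.div r)
    have k2 := real_inner_comm (BrokenH1.grad w) (Hdiv.val r)
    linarith
  have hR : WithLp.toLp 2 (BrokenH1.grad z, BrokenH1.val z) ∈ Hdiv Ω :=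
    mem_Hdiv_of_inner fun φ =>
      (hz (H1.toBroken P (testH1 φ))).trans (Hdiv.inner_add_eq_zero r (testH1_mem_H10 φ))
  refine ⟨⟨_, hR⟩, z, fun m => ?_, ?_, ?_⟩
  · refine Submodule.linearMap_qext _ (LinearMap.ext fun v => ?_)
    obtain ⟨e, he⟩ := exists_broken_extension P m v
    exact (he ⟨_, hR⟩).symm.trans ((hz e).trans (he r))
  · refine (sq_eq_sq₀ (norm_nonneg _) (norm_nonneg _)).1 ?_
    rw [Hdiv.norm_sq, BrokenH1.norm_sq]
    exact add_comm _ _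
  · rw [← hz z, BrokenH1.norm_sq, real_inner_self_eq_norm_sq, real_inner_self_eq_norm_sq,
      add_comm]

end Skeleton

variable {Ω : Opens Plane} {n : ℕ} (P : Partition Ω n)

section Norms

lemma normTestL2_eq (V : Test P) :
    normTestL2 P V =
      Real.sqrt (‖BrokenH1.val V.v‖ ^ 2 + ‖BrokenH1.val V.w‖ ^ 2 + ‖V.s‖ ^ 2 + ‖V.p‖ ^ 2) := by
  rw [normTestL2, normTestWeighted, P.norm_sq_eq_sum (BrokenH1.val V.v),
    P.norm_sq_eq_sum (BrokenH1.val V.w), P.norm_sq_eq_sum V.s, P.norm_sq_eq_sum V.p,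
    ← Finset.sum_add_distrib, ← Finset.sum_add_distrib, ← Finset.sum_add_distrib]
  congr 1
  refine Finset.sum_congr rfl fun m _ => ?_
  rw [BrokenH1.val_restrict, BrokenH1.val_restrict]
  ring

lemma normTestH1_eq (V : Test P) :
    normTestH1 P V = Real.sqrt (‖V.v‖ ^ 2 + ‖V.w‖ ^ 2 + ‖V.s‖ ^ 2 + ‖V.p‖ ^ 2) := by
  rw [normTestH1, normTestWeighted, BrokenH1.norm_sq, BrokenH1.norm_sq,
    P.norm_sq_eq_sum (BrokenH1.val V.v), P.norm_sq_eq_sum (BrokenH1.grad V.v),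
    P.norm_sq_eq_sum (BrokenH1.val V.w), P.norm_sq_eq_sum (BrokenH1.grad V.w),
    P.norm_sq_eq_sum V.s, P.norm_sq_eq_sum V.p,
    ← Finset.sum_add_distrib, ← Finset.sum_add_distrib, ← Finset.sum_add_distrib,
    ← Finset.sum_add_distrib, ← Finset.sum_add_distrib]
  congr 1
  refine Finset.sum_congr rfl fun m _ => ?_
  rw [BrokenH1.val_restrict, BrokenH1.val_restrict, BrokenH1.grad_restrict,
    BrokenH1.grad_restrict]
  ring

lemma normTestWeighted_mono {c d : Fin n → ℝ} (h : ∀ m, c m ^ 2 ≤ d m ^ 2) (V : Test P) :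
    normTestWeighted P c V ≤ normTestWeighted P d V := by
  refine Real.sqrt_le_sqrt (Finset.sum_le_sum fun m _ => ?_)
  have h1 := mul_le_mul_of_nonneg_right (h m) (sq_nonneg ‖H1.grad (BrokenH1.restrict V.v m)‖)
  have h2 := mul_le_mul_of_nonneg_right (h m) (sq_nonneg ‖H1.grad (BrokenH1.restrict V.w m)‖)
  linarith

lemma normTestL2_le (c : Fin n → ℝ) (V : Test P) : normTestL2 P V ≤ normTestWeighted P c V :=
  normTestWeighted_mono P (fun m => by simpa using sq_nonneg (c m)) V

lemma normTestWeighted_nonneg (c : Fin n → ℝ) (V : Test P) : 0 ≤ normTestWeighted P c V :=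
  Real.sqrt_nonneg _

lemma normTest_le {R : ℝ} (hR : 1 ≤ R) (h : ∀ m, Metric.diam (P.elem m : Set Plane) ≤ R)
    (V : Test P) : normTest P V ≤ R * normTestH1 P V := by
  rw [normTest, normTestH1, normTestWeighted, normTestWeighted,
    ← Real.sqrt_sq (zero_le_one.trans hR), ← Real.sqrt_mul (sq_nonneg R)]
  refine Real.sqrt_le_sqrt ?_
  rw [Finset.mul_sum]
  refine Finset.sum_le_sum fun m _ => ?_
  have h1 : Metric.diam (P.elem m : Set Plane) ^ 2 ≤ R ^ 2 :=
    pow_le_pow_left₀ Metric.diam_nonneg (h m) 2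
  have h2 : 1 ≤ R ^ 2 := one_le_pow₀ hR
  have g : ∀ x : ℝ, x ^ 2 ≤ R ^ 2 * x ^ 2 := fun x => le_mul_of_one_le_left (sq_nonneg x) h2
  have k1 := mul_le_mul_of_nonneg_right h1 (sq_nonneg ‖H1.grad (BrokenH1.restrict V.v m)‖)
  have k2 := mul_le_mul_of_nonneg_right h1 (sq_nonneg ‖H1.grad (BrokenH1.restrict V.w m)‖)
  have k3 := g ‖H1.val (BrokenH1.restrict V.v m)‖
  have k4 := g ‖H1.val (BrokenH1.restrict V.w m)‖
  have k5 := g ‖restrictL2 (P.le m) V.s‖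
  have k6 := g ‖restrictL2 (P.le m) V.p‖
  linarith

lemma le_sqrt_sum {a b c d : ℝ} :
    a ≤ Real.sqrt (a ^ 2 + b ^ 2 + c ^ 2 + d ^ 2) ∧ b ≤ Real.sqrt (a ^ 2 + b ^ 2 + c ^ 2 + d ^ 2) ∧
    c ≤ Real.sqrt (a ^ 2 + b ^ 2 + c ^ 2 + d ^ 2) ∧
    d ≤ Real.sqrt (a ^ 2 + b ^ 2 + c ^ 2 + d ^ 2) := by
  refine ⟨?_, ?_, ?_, ?_⟩ <;> refine Real.le_sqrt_of_sq_le ?_ <;>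
    linarith [sq_nonneg a, sq_nonneg b, sq_nonneg c, sq_nonneg d]

lemma sqrt_sum_le {a b c d x : ℝ} (ha : 0 ≤ a) (hb : 0 ≤ b) (hc : 0 ≤ c) (hd : 0 ≤ d)
    (ha' : a ≤ x) (hb' : b ≤ x) (hc' : c ≤ x) (hd' : d ≤ x) :
    Real.sqrt (a ^ 2 + b ^ 2 + c ^ 2 + d ^ 2) ≤ 2 * x := by
  refine Real.sqrt_le_iff.2 ⟨by linarith, ?_⟩
  have h1 := pow_le_pow_left₀ ha ha' 2
  have h2 := pow_le_pow_left₀ hb hb' 2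
  have h3 := pow_le_pow_left₀ hc hc' 2
  have h4 := pow_le_pow_left₀ hd hd' 2
  linarith

lemma BrokenH1.norm_val_le {P : Partition Ω n} (v : BrokenH1 P) : ‖BrokenH1.val v‖ ≤ ‖v‖ :=
  abs_le_of_sq_le_sq' (by linarith [BrokenH1.norm_sq v, sq_nonneg ‖BrokenH1.grad v‖])
    (norm_nonneg _) |>.2

lemma BrokenH1.norm_grad_le {P : Partition Ω n} (v : BrokenH1 P) : ‖BrokenH1.grad v‖ ≤ ‖v‖ :=
  abs_le_of_sq_le_sq' (by linarith [BrokenH1.norm_sq v, sq_nonneg ‖BrokenH1.val v‖])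
    (norm_nonneg _) |>.2

lemma Hdiv.norm_val_le (r : Hdiv Ω) : ‖Hdiv.val r‖ ≤ ‖r‖ :=
  abs_le_of_sq_le_sq' (by linarith [Hdiv.norm_sq r, sq_nonneg ‖Hdiv.div r‖])
    (norm_nonneg _) |>.2

lemma Hdiv.norm_div_le (r : Hdiv Ω) : ‖Hdiv.div r‖ ≤ ‖r‖ :=
  abs_le_of_sq_le_sq' (by linarith [Hdiv.norm_sq r, sq_nonneg ‖Hdiv.val r‖])
    (norm_nonneg _) |>.2

lemma normSkeleton_nonneg (r t : Hdiv Ω) : 0 ≤ normSkeleton P r t :=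
  Real.sInf_nonneg fun x hx => by
    obtain ⟨R, T, -, rfl⟩ := hx
    exact Real.sqrt_nonneg _

lemma normSkeleton_le {r t R T : Hdiv Ω}
    (h : ∀ m, normalTrace (Hdiv.restrict (P.le m) R) = normalTrace (Hdiv.restrict (P.le m) r) ∧
      normalTrace (Hdiv.restrict (P.le m) T) = normalTrace (Hdiv.restrict (P.le m) t)) :
    normSkeleton P r t ≤ Real.sqrt (‖R‖ ^ 2 + ‖T‖ ^ 2) :=
  csInf_le ⟨0, fun x hx => by
    obtain ⟨R, T, -, rfl⟩ := hx
    exact Real.sqrt_nonneg _⟩ ⟨R, T, h, rfl⟩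

lemma normSkeleton_le_normTrial (U : Trial Ω) : normSkeleton P U.r U.t ≤ normTrial P U :=
  Real.le_sqrt_of_sq_le (le_add_of_nonneg_right (sq_nonneg _))

lemma normField_le_normTrial (U : Trial Ω) : normField U ≤ normTrial P U :=
  Real.le_sqrt_of_sq_le (le_add_of_nonneg_left (sq_nonneg _))

lemma normTrial_le_add (U : Trial Ω) : normTrial P U ≤ normSkeleton P U.r U.t + normField U := by
  have h1 := normSkeleton_nonneg P U.r U.t
  have h2 : 0 ≤ normField U := Real.sqrt_nonneg _
  refine Real.sqrt_le_iff.2 ⟨by positivity, ?_⟩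
  have := mul_nonneg h1 h2
  linarith [add_sq (normSkeleton P U.r U.t) (normField U)]

end Norms

section Continuity

variable {lam D : ℝ}

lemma formSkeleton_eq (U : Trial Ω) (V : Test P) :
    formSkeleton P lam D U V =
      D * (inner ℝ (Hdiv.val U.t) (BrokenH1.grad V.w) +
        inner ℝ (Hdiv.div U.t) (BrokenH1.val V.w)) +
      lam * (inner ℝ (Hdiv.val U.r) (BrokenH1.grad V.v) +
        inner ℝ (Hdiv.div U.r) (BrokenH1.val V.v)) := by
  rw [formSkeleton, Finset.sum_add_distrib, ← Finset.mul_sum, ← Finset.mul_sum,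
    sum_normalTrace, sum_normalTrace]

/-- The weak form is the `L²` pairing of the residuals with the test functions. -/
lemma form_eq (U : Trial Ω) (V : Test P) :
    form P lam D U V =
      inner ℝ (H1.grad U.u.1 - Hdiv.val U.r) V.s + inner ℝ (H1.grad U.q.1 - Hdiv.val U.t) V.p +
        inner ℝ (potentialResidual lam U) (BrokenH1.val V.v) +
        inner ℝ (-D • Hdiv.div U.t) (BrokenH1.val V.w) := by
  rw [form, formVolume, formSkeleton_eq, potentialResidual, inner_sub_left (-_), inner_neg_left,
    real_inner_smul_left, real_inner_smul_left]
  ring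

lemma abs_inner_le {F : Type} [NormedAddCommGroup F] [InnerProductSpace ℝ F] {x y : F} {a b : ℝ}
    (hx : ‖x‖ ≤ a) (hy : ‖y‖ ≤ b) : |inner ℝ x y| ≤ a * b :=
  (abs_real_inner_le_norm x y).trans
    (mul_le_mul hx hy (norm_nonneg _) ((norm_nonneg _).trans hx))

lemma abs_load_le (f : L2 Ω ℝ) (V : Test P) : |load P f V| ≤ ‖f‖ * normTestL2 P V := by
  rw [load, abs_neg, normTestL2_eq]
  exact abs_inner_le le_rfl le_sqrt_sum.2.1

lemma abs_form_le_normGraph (hlam : 0 < lam) (hD : 0 < D) (U : Trial Ω) (V : Test P) :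
    |form P lam D U V| ≤ (6 + lam + D) * normGraph U * normTestL2 P V := by
  obtain ⟨a1, a2, a3, a4⟩ := le_sqrt_sum (a := ‖U.u‖) (b := ‖U.q‖) (c := ‖U.r‖) (d := ‖U.t‖)
  obtain ⟨b1, b2, b3, b4⟩ := le_sqrt_sum (a := ‖BrokenH1.val V.v‖) (b := ‖BrokenH1.val V.w‖)
    (c := ‖V.s‖) (d := ‖V.p‖)
  rw [← normTestL2_eq] at b1 b2 b3 b4
  change _ ≤ normGraph U at a1 a2 a3 a4
  have h1 : ‖H1.grad U.u.1 - Hdiv.val U.r‖ ≤ normGraph U + normGraph U :=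
    (norm_sub_le _ _).trans (add_le_add ((norm_grad_le _).trans a1) ((Hdiv.norm_val_le _).trans a3))
  have h2 : ‖H1.grad U.q.1 - Hdiv.val U.t‖ ≤ normGraph U + normGraph U :=
    (norm_sub_le _ _).trans (add_le_add ((norm_grad_le _).trans a2) ((Hdiv.norm_val_le _).trans a4))
  have h3 : ‖potentialResidual lam U‖ ≤ normGraph U + normGraph U + lam * normGraph U := by
    refine (norm_sub_le _ _).trans (add_le_add ?_ ?_)
    · rw [norm_neg]
      exact (norm_add_le _ _).trans
        (add_le_add ((norm_val_le _).trans a1) ((norm_val_le _).trans a2))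
    · rw [norm_smul, Real.norm_of_nonneg hlam.le]
      exact mul_le_mul_of_nonneg_left ((Hdiv.norm_div_le _).trans a3) hlam.le
  have h4 : ‖-D • Hdiv.div U.t‖ ≤ D * normGraph U := by
    rw [norm_smul, norm_neg, Real.norm_of_nonneg hD.le]
    exact mul_le_mul_of_nonneg_left ((Hdiv.norm_div_le _).trans a4) hD.le
  rw [form_eq]
  have e1 := abs_inner_le h1 b3
  have e2 := abs_inner_le h2 b4
  have e3 := abs_inner_le h3 b1
  have e4 := abs_inner_le h4 b2
  refine (abs_add_le _ _).trans ((add_le_add (((abs_add_le _ _).trans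
    (add_le_add ((abs_add_le _ _).trans (add_le_add e1 e2)) e3))) e4).trans_eq ?_)
  ring

lemma abs_formVolume_le (hlam : 0 < lam) (hD : 0 < D) {U : Trial Ω} {x : ℝ}
    (hu : ‖U.u‖ ≤ x) (hq : ‖U.q‖ ≤ x) (hr : ‖Hdiv.val U.r‖ ≤ x) (ht : ‖Hdiv.val U.t‖ ≤ x)
    (V : Test P) : |formVolume P lam D U V| ≤ (6 + lam + D) * x * normTestH1 P V := by
  obtain ⟨b1, b2, b3, b4⟩ := le_sqrt_sum (a := ‖V.v‖) (b := ‖V.w‖) (c := ‖V.s‖) (d := ‖V.p‖)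
  rw [← normTestH1_eq] at b1 b2 b3 b4
  have h1 : ‖H1.grad U.u.1 - Hdiv.val U.r‖ ≤ x + x :=
    (norm_sub_le _ _).trans (add_le_add ((norm_grad_le _).trans hu) hr)
  have h2 : ‖H1.grad U.q.1 - Hdiv.val U.t‖ ≤ x + x :=
    (norm_sub_le _ _).trans (add_le_add ((norm_grad_le _).trans hq) ht)
  have h3 : ‖H1.val U.u.1 + H1.val U.q.1‖ ≤ x + x :=
    (norm_add_le _ _).trans (add_le_add ((norm_val_le _).trans hu) ((norm_val_le _).trans hq))
  have e1 := abs_inner_le h1 b3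
  have e2 := abs_inner_le h2 b4
  have e3 := abs_inner_le h3 ((BrokenH1.norm_val_le V.v).trans b1)
  have e4 := mul_le_mul_of_nonneg_left (abs_inner_le hr ((BrokenH1.norm_grad_le V.v).trans b1))
    hlam.le
  have e5 := mul_le_mul_of_nonneg_left (abs_inner_le ht ((BrokenH1.norm_grad_le V.w).trans b2))
    hD.le
  rw [← abs_of_pos hlam, ← abs_mul, abs_of_pos hlam] at e4
  rw [← abs_of_pos hD, ← abs_mul, abs_of_pos hD] at e5
  rw [formVolume]
  refine (abs_add_le _ _).trans ((add_le_add ((abs_add_le _ _).trans (add_le_add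
    ((abs_sub _ _).trans (add_le_add ((abs_add_le _ _).trans (add_le_add e1 e2)) e3)) e4))
    e5).trans_eq ?_)
  ring

lemma abs_formSkeleton_le (hlam : 0 < lam) (hD : 0 < D) (U : Trial Ω) (V : Test P) :
    |formSkeleton P lam D U V| ≤ 2 * (lam + D) * normSkeleton P U.r U.t * normTestH1 P V := by
  obtain ⟨b1, b2, -, -⟩ := le_sqrt_sum (a := ‖V.v‖) (b := ‖V.w‖) (c := ‖V.s‖) (d := ‖V.p‖)
  rw [← normTestH1_eq] at b1 b2
  have hn : 0 ≤ normTestH1 P V := normTestWeighted_nonneg P _ V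
  have key : ∀ x ∈ {x : ℝ | ∃ R T : Hdiv Ω,
      (∀ m, normalTrace (Hdiv.restrict (P.le m) R) = normalTrace (Hdiv.restrict (P.le m) U.r) ∧
        normalTrace (Hdiv.restrict (P.le m) T) = normalTrace (Hdiv.restrict (P.le m) U.t)) ∧
      x = Real.sqrt (‖R‖ ^ 2 + ‖T‖ ^ 2)},
      |formSkeleton P lam D U V| ≤ 2 * (lam + D) * normTestH1 P V * x := by
    rintro x ⟨R, T, h, rfl⟩
    have hs : formSkeleton P lam D U V = formSkeleton P lam D ⟨U.u, U.q, R, T⟩ V :=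
      Finset.sum_congr rfl fun m _ => by rw [(h m).1, (h m).2]
    have c1 : ‖R‖ ≤ Real.sqrt (‖R‖ ^ 2 + ‖T‖ ^ 2) :=
      Real.le_sqrt_of_sq_le (le_add_of_nonneg_right (sq_nonneg _))
    have c2 : ‖T‖ ≤ Real.sqrt (‖R‖ ^ 2 + ‖T‖ ^ 2) :=
      Real.le_sqrt_of_sq_le (le_add_of_nonneg_left (sq_nonneg _))
    have e1 := abs_inner_le ((Hdiv.norm_val_le R).trans c1) ((BrokenH1.norm_grad_le V.v).trans b1)
    have e2 := abs_inner_le ((Hdiv.norm_div_le R).trans c1) ((BrokenH1.norm_val_le V.v).trans b1)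
    have e3 := abs_inner_le ((Hdiv.norm_val_le T).trans c2) ((BrokenH1.norm_grad_le V.w).trans b2)
    have e4 := abs_inner_le ((Hdiv.norm_div_le T).trans c2) ((BrokenH1.norm_val_le V.w).trans b2)
    have f1 := mul_le_mul_of_nonneg_left ((abs_add_le _ _).trans (add_le_add e1 e2)) hlam.le
    have f2 := mul_le_mul_of_nonneg_left ((abs_add_le _ _).trans (add_le_add e3 e4)) hD.le
    rw [← abs_of_pos hlam, ← abs_mul, abs_of_pos hlam] at f1
    rw [← abs_of_pos hD, ← abs_mul, abs_of_pos hD] at f2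
    rw [hs, formSkeleton_eq]
    refine (abs_add_le _ _).trans ((add_le_add f2 f1).trans_eq ?_)
    ring
  have hne : {x : ℝ | ∃ R T : Hdiv Ω,
      (∀ m, normalTrace (Hdiv.restrict (P.le m) R) = normalTrace (Hdiv.restrict (P.le m) U.r) ∧
        normalTrace (Hdiv.restrict (P.le m) T) = normalTrace (Hdiv.restrict (P.le m) U.t)) ∧
      x = Real.sqrt (‖R‖ ^ 2 + ‖T‖ ^ 2)}.Nonempty :=
    ⟨_, U.r, U.t, fun m => ⟨rfl, rfl⟩, rfl⟩
  rw [mul_right_comm]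
  rcases hn.eq_or_lt with h0 | h0
  · obtain ⟨x, hx⟩ := hne
    have := key x hx
    rw [← h0] at this ⊢
    simpa using this
  · have hpos : 0 < 2 * (lam + D) * normTestH1 P V := by positivity
    rw [← div_le_iff₀' hpos]
    exact le_csInf hne fun x hx => (div_le_iff₀' hpos).2 (key x hx)

lemma abs_form_le_normTrial (hlam : 0 < lam) (hD : 0 < D) (U : Trial Ω) (V : Test P) :
    |form P lam D U V| ≤ (6 + 3 * lam + 3 * D) * normTrial P U * normTestH1 P V := by
  obtain ⟨a1, a2, a3, a4⟩ := le_sqrt_sum (a := ‖U.u‖) (b := ‖U.q‖) (c := ‖Hdiv.val U.r‖)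
    (d := ‖Hdiv.val U.t‖)
  have hf := normField_le_normTrial P U
  have h1 := abs_formVolume_le P hlam hD (a1.trans hf) (a2.trans hf) (a3.trans hf) (a4.trans hf) V
  have h2 := abs_formSkeleton_le P hlam hD U V
  have hn : 0 ≤ normTestH1 P V := normTestWeighted_nonneg P _ V
  have h3 : 2 * (lam + D) * normSkeleton P U.r U.t * normTestH1 P V ≤
      2 * (lam + D) * normTrial P U * normTestH1 P V := by
    gcongr
    exact normSkeleton_le_normTrial P U
  rw [form]
  refine (abs_sub _ _).trans ((add_le_add h1 (h2.trans h3)).trans_eq ?_)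
  ring

end Continuity

variable {Ω : Opens Plane} {n : ℕ} (P : Partition Ω n)

section Stability

variable {lam D : ℝ}

lemma le_of_sq_le_mul {x y : ℝ} (hx : 0 ≤ x) (hy : 0 ≤ y) (h : x ^ 2 ≤ y * x) : x ≤ y := by
  rcases hx.eq_or_lt with h0 | h0
  · rwa [← h0]
  · rw [sq] at h
    exact le_of_mul_le_mul_right h h0

/-- An `L²` function is controlled by its action on test functions. -/
lemma norm_le_of_inner_testH1 (g : L2 Ω ℝ) {σ : ℝ} (hσ : 0 ≤ σ)
    (h : ∀ φ : 𝓓(Ω, ℝ), |inner ℝ g (H1.val (testH1 φ))| ≤ σ * ‖H1.val (testH1 φ)‖) :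
    ‖g‖ ≤ σ := by
  set S : Submodule ℝ (L2 Ω ℝ) := (smoothH1 Ω).map (valCLM Ω : H1 Ω →ₗ[ℝ] L2 Ω ℝ) with hS
  have hbot : Sᗮ = ⊥ := by
    refine (Submodule.eq_bot_iff _).2 fun f hf => eq_zero_of_inner_testH1 f fun φ => ?_
    refine (Submodule.mem_orthogonal' _ _).1 hf _ ⟨testH1 φ, ?_, rfl⟩
    exact Submodule.subset_span ⟨φ, coeFn_val_testH1 φ, coeFn_grad_testH1 φ⟩
  have htop : S.topologicalClosure = ⊤ := Submodule.topologicalClosure_eq_top_iff.2 hbot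
  have hclosed : IsClosed {f : L2 Ω ℝ | |inner ℝ g f| ≤ σ * ‖f‖} :=
    isClosed_le (continuous_const.inner continuous_id).abs (continuous_norm.const_mul σ)
  have hsub : (S : Set (L2 Ω ℝ)) ⊆ {f : L2 Ω ℝ | |inner ℝ g f| ≤ σ * ‖f‖} := by
    rintro _ ⟨p, hp, rfl⟩
    obtain ⟨φ, rfl⟩ := exists_eq_testH1 hp
    exact h φ
  have hg : g ∈ S.topologicalClosure := htop ▸ Submodule.mem_top
  have h1 : |inner ℝ g g| ≤ σ * ‖g‖ := closure_minimal hsub hclosed hg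
  rw [real_inner_self_eq_norm_sq, abs_of_nonneg (sq_nonneg _)] at h1
  exact le_of_sq_le_mul (norm_nonneg _) hσ h1

lemma H1.val_toBroken (v : H1 Ω) : BrokenH1.val (H1.toBroken P v) = H1.val v := rfl

lemma H1.norm_toBroken (v : H1 Ω) : ‖H1.toBroken P v‖ = ‖v‖ := rfl

lemma form_sp (U : Trial Ω) (s p : L2 Ω Plane) :
    form P lam D U ⟨0, 0, s, p⟩ =
      inner ℝ (H1.grad U.u.1 - Hdiv.val U.r) s + inner ℝ (H1.grad U.q.1 - Hdiv.val U.t) p := by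
  rw [form_eq]
  have : BrokenH1.val (0 : BrokenH1 P) = 0 := rfl
  simp only [this, inner_zero_right, add_zero]

lemma form_vw (U : Trial Ω) (v w : BrokenH1 P) :
    form P lam D U ⟨v, w, 0, 0⟩ =
      inner ℝ (potentialResidual lam U) (BrokenH1.val v) +
        inner ℝ (-D • Hdiv.div U.t) (BrokenH1.val w) := by
  rw [form_eq]
  simp only [inner_zero_right, zero_add]

/-- The fields are controlled by the action of the weak form in the broken `H¹` norm. -/
theorem exists_field_bound_of_form (hΩ : Bornology.IsBounded (Ω : Set Plane)) (hlam : 0 < lam)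
    (hD : 0 < D) (hker : ∀ μ : ℝ, IsDirichletEigenvalue Ω μ → lam * μ ≠ 1) :
    ∃ C : ℝ, 0 < C ∧ ∀ (n : ℕ) (P : Partition Ω n) (U : Trial Ω) (σ : ℝ), 0 ≤ σ →
      (∀ V, |form P lam D U V| ≤ σ * normTestH1 P V) →
      ‖U.u‖ ≤ C * σ ∧ ‖U.q‖ ≤ C * σ ∧ ‖Hdiv.val U.r‖ ≤ C * σ ∧ ‖Hdiv.val U.t‖ ≤ C * σ := by
  obtain ⟨C, hC, h⟩ := exists_field_bound hΩ hlam hD hker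
  refine ⟨C, hC, fun n P U σ hσ hU => h U σ hσ ?_ ?_ ?_ ?_⟩
  · refine le_of_sq_le_mul (norm_nonneg _) hσ ?_
    have h1 := (le_abs_self _).trans (hU ⟨0, 0, H1.grad U.u.1 - Hdiv.val U.r, 0⟩)
    rw [form_sp, normTestH1_eq, inner_zero_right, real_inner_self_eq_norm_sq] at h1
    simpa using h1
  · refine le_of_sq_le_mul (norm_nonneg _) hσ ?_
    have h1 := (le_abs_self _).trans (hU ⟨0, 0, 0, H1.grad U.q.1 - Hdiv.val U.t⟩)
    rw [form_sp, normTestH1_eq, inner_zero_right, real_inner_self_eq_norm_sq] at h1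
    simpa using h1
  · intro v _
    have h1 := hU ⟨H1.toBroken P v, 0, 0, 0⟩
    have h0 : BrokenH1.val (0 : BrokenH1 P) = 0 := rfl
    rw [form_vw, normTestH1_eq, h0, inner_zero_right, H1.val_toBroken, H1.norm_toBroken] at h1
    simpa using h1
  · intro w _
    have h1 := hU ⟨0, H1.toBroken P w, 0, 0⟩
    have h0 : BrokenH1.val (0 : BrokenH1 P) = 0 := rfl
    rw [form_vw, normTestH1_eq, h0, inner_zero_right, H1.val_toBroken, H1.norm_toBroken] at h1
    simpa using h1

/-- Stability in the trial norm, uniformly in the partition. -/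
theorem exists_normTrial_bound (hΩ : Bornology.IsBounded (Ω : Set Plane)) (hlam : 0 < lam)
    (hD : 0 < D) (hker : ∀ μ : ℝ, IsDirichletEigenvalue Ω μ → lam * μ ≠ 1) :
    ∃ C : ℝ, 0 < C ∧ ∀ (n : ℕ) (P : Partition Ω n) (U : Trial Ω) (σ : ℝ), 0 ≤ σ →
      (∀ V, |form P lam D U V| ≤ σ * normTestH1 P V) → normTrial P U ≤ C * σ := by
  obtain ⟨C, hC, h⟩ := exists_field_bound_of_form hΩ hlam hD hker
  set μ := min lam D with hμ
  have hμ0 : 0 < μ := lt_min hlam hD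
  set A := ((6 + lam + D) * C + 1) / μ with hA
  have hA0 : 0 < A := by positivity
  refine ⟨A + 2 * C, by positivity, fun n P U σ hσ hU => ?_⟩
  obtain ⟨hu, hq, hr, ht⟩ := h n P U σ hσ hU
  obtain ⟨R, z, hR, hRz, hz⟩ := exists_minimal_extension P U.r
  obtain ⟨T, y, hT, hTy, hy⟩ := exists_minimal_extension P U.t
  have hN : normTestH1 P ⟨z, y, 0, 0⟩ = Real.sqrt (‖z‖ ^ 2 + ‖y‖ ^ 2) := by
    rw [normTestH1_eq]
    simp
  have hskel : normSkeleton P U.r U.t ≤ A * σ := by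
    have h1 := normSkeleton_le P fun m => ⟨hR m, hT m⟩
    rw [hRz, hTy] at h1
    refine h1.trans (le_of_sq_le_mul (Real.sqrt_nonneg _) (by positivity) ?_)
    have h2 := abs_formVolume_le P hlam hD hu hq hr ht ⟨z, y, 0, 0⟩
    have h3 := hU ⟨z, y, 0, 0⟩
    have h4 : formSkeleton P lam D U ⟨z, y, 0, 0⟩ = D * ‖y‖ ^ 2 + lam * ‖z‖ ^ 2 := by
      rw [formSkeleton_eq, hz, hy]
    have h5 : formSkeleton P lam D U ⟨z, y, 0, 0⟩ =
        formVolume P lam D U ⟨z, y, 0, 0⟩ - form P lam D U ⟨z, y, 0, 0⟩ := by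
      rw [form]
      ring
    rw [hN] at h2 h3
    set N := Real.sqrt (‖z‖ ^ 2 + ‖y‖ ^ 2) with hN'
    have hNsq : N ^ 2 = ‖z‖ ^ 2 + ‖y‖ ^ 2 := Real.sq_sqrt (by positivity)
    have h6 : μ * N ^ 2 ≤ D * ‖y‖ ^ 2 + lam * ‖z‖ ^ 2 := by
      have k1 := mul_le_mul_of_nonneg_right (min_le_left lam D) (sq_nonneg ‖z‖)
      have k2 := mul_le_mul_of_nonneg_right (min_le_right lam D) (sq_nonneg ‖y‖)
      rw [hNsq, hμ]
      linarith
    have h7 : D * ‖y‖ ^ 2 + lam * ‖z‖ ^ 2 ≤ ((6 + lam + D) * C + 1) * σ * N := by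
      rw [← h4, h5]
      refine (le_abs_self _).trans ((abs_sub _ _).trans ((add_le_add h2 h3).trans_eq ?_))
      ring
    rw [hA, div_mul_eq_mul_div, div_mul_eq_mul_div, le_div_iff₀ hμ0]
    linarith
  have hfield : normField U ≤ 2 * (C * σ) :=
    sqrt_sum_le (norm_nonneg _) (norm_nonneg _) (norm_nonneg _) (norm_nonneg _) hu hq hr ht
  linarith [normTrial_le_add P U]

/-- Stability in the graph norm, uniformly in the partition. -/
theorem exists_normGraph_bound (hΩ : Bornology.IsBounded (Ω : Set Plane)) (hlam : 0 < lam)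
    (hD : 0 < D) (hker : ∀ μ : ℝ, IsDirichletEigenvalue Ω μ → lam * μ ≠ 1) :
    ∃ C : ℝ, 0 < C ∧ ∀ (n : ℕ) (P : Partition Ω n) (U : Trial Ω) (σ : ℝ), 0 ≤ σ →
      (∀ V, |form P lam D U V| ≤ σ * normTestL2 P V) → normGraph U ≤ C * σ := by
  obtain ⟨C, hC, h⟩ := exists_field_bound_of_form hΩ hlam hD hker
  set A := C + lam⁻¹ * (2 * C + 1) + D⁻¹ with hA
  refine ⟨2 * A, by positivity, fun n P U σ hσ hU => ?_⟩
  obtain ⟨hu, hq, hr, ht⟩ := h n P U σ hσ fun V =>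
    (hU V).trans (mul_le_mul_of_nonneg_left (normTestL2_le P _ V) hσ)
  have h0 : BrokenH1.val (0 : BrokenH1 P) = 0 := rfl
  have h3 : ‖potentialResidual lam U‖ ≤ σ := norm_le_of_inner_testH1 _ hσ fun φ => by
    have h1 := hU ⟨H1.toBroken P (testH1 φ), 0, 0, 0⟩
    rw [form_vw, normTestL2_eq, h0, inner_zero_right, H1.val_toBroken] at h1
    simpa using h1
  have h4 : ‖-D • Hdiv.div U.t‖ ≤ σ := norm_le_of_inner_testH1 _ hσ fun φ => by
    have h1 := hU ⟨0, H1.toBroken P (testH1 φ), 0, 0⟩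
    rw [form_vw, normTestL2_eq, h0, inner_zero_right, H1.val_toBroken] at h1
    simpa using h1
  have ht' : ‖Hdiv.div U.t‖ ≤ D⁻¹ * σ := by
    rw [norm_smul, norm_neg, Real.norm_of_nonneg hD.le] at h4
    rwa [inv_mul_eq_div, le_div_iff₀' hD]
  have hr' : ‖Hdiv.div U.r‖ ≤ lam⁻¹ * (2 * C + 1) * σ := by
    have e : lam • Hdiv.div U.r =
        -(H1.val U.u.1 + H1.val U.q.1) - potentialResidual lam U := by
      rw [potentialResidual]
      abel
    have e1 : lam * ‖Hdiv.div U.r‖ ≤ (C * σ + C * σ) + σ := by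
      have e2 : lam * ‖Hdiv.div U.r‖ = ‖lam • Hdiv.div U.r‖ := by
        rw [norm_smul, Real.norm_of_nonneg hlam.le]
      rw [e2, e]
      refine (norm_sub_le _ _).trans (add_le_add ?_ h3)
      rw [norm_neg]
      exact (norm_add_le _ _).trans
        (add_le_add ((norm_val_le _).trans hu) ((norm_val_le _).trans hq))
    rw [mul_assoc, inv_mul_eq_div, le_div_iff₀' hlam]
    linarith
  have g : ∀ (r : Hdiv Ω) {a b : ℝ}, ‖Hdiv.val r‖ ≤ a → ‖Hdiv.div r‖ ≤ b → ‖r‖ ≤ a + b := by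
    intro r a b h1 h2
    refine abs_le_of_sq_le_sq' ?_ (add_nonneg ((norm_nonneg _).trans h1)
      ((norm_nonneg _).trans h2)) |>.2
    have k1 := pow_le_pow_left₀ (norm_nonneg _) h1 2
    have k2 := pow_le_pow_left₀ (norm_nonneg _) h2 2
    have k3 := mul_nonneg ((norm_nonneg _).trans h1) ((norm_nonneg _).trans h2)
    rw [Hdiv.norm_sq]
    linarith [add_sq a b]
  have p1 : 0 ≤ lam⁻¹ * (2 * C + 1) * σ := by positivity
  have p2 : 0 ≤ D⁻¹ * σ := by positivity
  have hA' : A * σ = C * σ + lam⁻¹ * (2 * C + 1) * σ + D⁻¹ * σ := by rw [hA]; ring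
  rw [mul_assoc]
  refine sqrt_sum_le (norm_nonneg _) (norm_nonneg _) (norm_nonneg _) (norm_nonneg _) ?_ ?_ ?_ ?_
  · linarith
  · linarith
  · linarith [g U.r hr hr']
  · linarith [g U.t ht ht']

/-- A stability estimate is an inf-sup condition. -/
lemma infSup_of_bound {C K : ℝ} (hC : 0 ≤ C) (hCK : C * K ≤ 1) {normU : Trial Ω → ℝ}
    {normV : Test P → ℝ} (h0 : ∀ V, 0 ≤ normV V) (hzero : ∀ U V, normV V = 0 → form P lam D U V = 0)
    (h : ∀ (U : Trial Ω) (σ : ℝ), 0 ≤ σ → (∀ V, |form P lam D U V| ≤ σ * normV V) →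
      normU U ≤ K * σ) : InfSup P lam D C normU normV := by
  intro U
  set S := ⨆ V : Test P, ENNReal.ofReal (|form P lam D U V| / normV V) with hS
  by_cases htop : S = ⊤
  · rw [htop]
    exact le_top
  rw [ENNReal.ofReal_le_iff_le_toReal htop]
  have h1 := h U S.toReal ENNReal.toReal_nonneg fun V => by
    rcases (h0 V).eq_or_lt with hV | hV
    · rw [hzero U V hV.symm, ← hV]
      simp
    · rw [← div_le_iff₀ hV]
      exact (ENNReal.ofReal_le_iff_le_toReal htop).1
        (le_iSup (fun V : Test P => ENNReal.ofReal (|form P lam D U V| / normV V)) V)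
  calc C * normU U ≤ C * (K * S.toReal) := mul_le_mul_of_nonneg_left h1 hC
    _ = C * K * S.toReal := by ring
    _ ≤ S.toReal := mul_le_of_le_one_left ENNReal.toReal_nonneg hCK

lemma form_eq_zero_of_normTestWeighted (hlam : 0 < lam) (hD : 0 < D) (c : Fin n → ℝ) (U : Trial Ω)
    (V : Test P) (h : normTestWeighted P c V = 0) : form P lam D U V = 0 := by
  have h1 : normTestL2 P V = 0 :=
    le_antisymm ((normTestL2_le P c V).trans_eq h) (normTestWeighted_nonneg P _ V)
  have h2 := abs_form_le_normGraph P hlam hD U V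
  rw [h1, mul_zero] at h2
  exact abs_eq_zero.1 (le_antisymm h2 (abs_nonneg _))

lemma form_sub (U₁ U₂ : Trial Ω) (V : Test P) :
    form P lam D ⟨U₁.u - U₂.u, U₁.q - U₂.q, U₁.r - U₂.r, U₁.t - U₂.t⟩ V =
      form P lam D U₁ V - form P lam D U₂ V := by
  have hr : potentialResidual lam ⟨U₁.u - U₂.u, U₁.q - U₂.q, U₁.r - U₂.r, U₁.t - U₂.t⟩ =
      potentialResidual lam U₁ - potentialResidual lam U₂ := by
    show -((H1.val U₁.u.1 - H1.val U₂.u.1) + (H1.val U₁.q.1 - H1.val U₂.q.1)) -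
      lam • (Hdiv.div U₁.r - Hdiv.div U₂.r) = _
    rw [potentialResidual, potentialResidual]
    module
  have h1 : H1.grad (U₁.u - U₂.u).1 - Hdiv.val (U₁.r - U₂.r) =
      (H1.grad U₁.u.1 - Hdiv.val U₁.r) - (H1.grad U₂.u.1 - Hdiv.val U₂.r) := by
    show (H1.grad U₁.u.1 - H1.grad U₂.u.1) - (Hdiv.val U₁.r - Hdiv.val U₂.r) = _
    abel
  have h2 : H1.grad (U₁.q - U₂.q).1 - Hdiv.val (U₁.t - U₂.t) =
      (H1.grad U₁.q.1 - Hdiv.val U₁.t) - (H1.grad U₂.q.1 - Hdiv.val U₂.t) := by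
    show (H1.grad U₁.q.1 - H1.grad U₂.q.1) - (Hdiv.val U₁.t - Hdiv.val U₂.t) = _
    abel
  have h3 : -D • Hdiv.div (U₁.t - U₂.t) = -D • Hdiv.div U₁.t - -D • Hdiv.div U₂.t := by
    show -D • (Hdiv.div U₁.t - Hdiv.div U₂.t) = _
    rw [smul_sub]
  have h := form_eq P (lam := lam) (D := D)
    ⟨U₁.u - U₂.u, U₁.q - U₂.q, U₁.r - U₂.r, U₁.t - U₂.t⟩ V
  dsimp only at h
  rw [hr, h1, h2, h3, inner_sub_left (H1.grad U₁.u.1 - _), inner_sub_left (H1.grad U₁.q.1 - _),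
    inner_sub_left (potentialResidual lam U₁), inner_sub_left (-D • _)] at h
  rw [h, form_eq, form_eq]
  ring

lemma eq_of_normGraph_sub_eq_zero {U₁ U₂ : Trial Ω}
    (h : normGraph ⟨U₁.u - U₂.u, U₁.q - U₂.q, U₁.r - U₂.r, U₁.t - U₂.t⟩ ≤ 0) : U₁ = U₂ := by
  obtain ⟨a1, a2, a3, a4⟩ := le_sqrt_sum (a := ‖U₁.u - U₂.u‖) (b := ‖U₁.q - U₂.q‖)
    (c := ‖U₁.r - U₂.r‖) (d := ‖U₁.t - U₂.t‖)
  exact Trial.ext (sub_eq_zero.1 (norm_le_zero_iff.1 (a1.trans h)))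
    (sub_eq_zero.1 (norm_le_zero_iff.1 (a2.trans h)))
    (sub_eq_zero.1 (norm_le_zero_iff.1 (a3.trans h)))
    (sub_eq_zero.1 (norm_le_zero_iff.1 (a4.trans h)))

/-- Only the zero test function annihilates all trial functions. -/
theorem test_eq_zero_of_form_eq_zero (hΩ : Bornology.IsBounded (Ω : Set Plane)) (hlam : 0 < lam)
    (hD : 0 < D) (hker : ∀ μ : ℝ, IsDirichletEigenvalue Ω μ → lam * μ ≠ 1) (V : Test P)
    (hV : ∀ U, form P lam D U V = 0) : V.v = 0 ∧ V.w = 0 ∧ V.s = 0 ∧ V.p = 0 := by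
  obtain ⟨U, h1, h2, h3, h4⟩ :=
    exists_trial hΩ hlam hD hker V.s V.p (BrokenH1.val V.v) (BrokenH1.val V.w)
  have h := hV U
  rw [form_eq, h1, h2, h3, h4] at h
  simp only [real_inner_self_eq_norm_sq] at h
  have e1 := sq_nonneg ‖V.s‖
  have e2 := sq_nonneg ‖V.p‖
  have e3 := sq_nonneg ‖BrokenH1.val V.v‖
  have e4 := sq_nonneg ‖BrokenH1.val V.w‖
  have z : ∀ x : ℝ, 0 ≤ x ^ 2 → x ^ 2 ≤ 0 → x = 0 := fun x h1 h2 =>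
    pow_eq_zero_iff two_ne_zero |>.1 (le_antisymm h2 h1)
  exact ⟨BrokenH1.eq_zero_of_val_eq_zero (norm_eq_zero.1 (z _ e3 (by linarith))),
    BrokenH1.eq_zero_of_val_eq_zero (norm_eq_zero.1 (z _ e4 (by linarith))),
    norm_eq_zero.1 (z _ e1 (by linarith)), norm_eq_zero.1 (z _ e2 (by linarith))⟩

theorem exists_solution (hΩ : Bornology.IsBounded (Ω : Set Plane)) (hlam : 0 < lam)
    (hD : 0 < D) (hker : ∀ μ : ℝ, IsDirichletEigenvalue Ω μ → lam * μ ≠ 1) (f : L2 Ω ℝ) :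
    ∃ U, ∀ V, form P lam D U V = load P f V := by
  obtain ⟨U, h1, h2, h3, h4⟩ := exists_trial hΩ hlam hD hker 0 0 0 (-f)
  refine ⟨U, fun V => ?_⟩
  rw [form_eq, h1, h2, h3, h4, load]
  simp only [inner_zero_left, inner_neg_left, zero_add]

end Stability

end CahnHilliard

end

theorem mainTheorem1 (Ω : TopologicalSpace.Opens CahnHilliard.Plane)
    (hΩ : Bornology.IsBounded (Ω : Set CahnHilliard.Plane))
    (lam D : ℝ) (hlam : 0 < lam) (hD : 0 < D)
    (hker : ∀ μ : ℝ, CahnHilliard.IsDirichletEigenvalue Ω μ → lam * μ ≠ 1) :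
    ∃ C M : ℝ, 0 < C ∧ 0 < M ∧
      ∀ (n : ℕ) (P : CahnHilliard.Partition Ω n),
        -- continuity of the bilinear form and of the load
        (∀ U V, |CahnHilliard.form P lam D U V| ≤
          M * CahnHilliard.normTrial P U * CahnHilliard.normTestH1 P V) ∧
        (∀ U V, |CahnHilliard.form P lam D U V| ≤
          M * CahnHilliard.normGraph U * CahnHilliard.normTestL2 P V) ∧
        (∀ f V, |CahnHilliard.load P f V| ≤ ‖f‖ * CahnHilliard.normTestL2 P V) ∧
        -- inf-sup conditions
        CahnHilliard.InfSup P lam D C (CahnHilliard.normTrial P) (CahnHilliard.normTest P) ∧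
        CahnHilliard.InfSup P lam D C (CahnHilliard.normTrial P) (CahnHilliard.normTestH1 P) ∧
        CahnHilliard.InfSup P lam D C CahnHilliard.normGraph (CahnHilliard.normTestL2 P) ∧
        -- no nonzero test function annihilates all trial functions
        (∀ V : CahnHilliard.Test P, (∀ U, CahnHilliard.form P lam D U V = 0) →
          V.v = 0 ∧ V.w = 0 ∧ V.s = 0 ∧ V.p = 0) ∧
        -- unique solvability and stability
        ∀ f : CahnHilliard.L2 Ω ℝ,
          (∃! U, ∀ V, CahnHilliard.form P lam D U V = CahnHilliard.load P f V) ∧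
          ∀ U, (∀ V, CahnHilliard.form P lam D U V = CahnHilliard.load P f V) →
            C * CahnHilliard.normTrial P U ≤ ‖f‖ ∧ C * CahnHilliard.normGraph U ≤ ‖f‖ := by
  obtain ⟨K₁, hK₁, h₁⟩ := CahnHilliard.exists_normTrial_bound hΩ hlam hD hker
  obtain ⟨K₂, hK₂, h₂⟩ := CahnHilliard.exists_normGraph_bound hΩ hlam hD hker
  set R := max 1 (Metric.diam (Ω : Set CahnHilliard.Plane)) with hR
  have hR1 : 1 ≤ R := le_max_left _ _
  have hR0 : 0 < R := one_pos.trans_le hR1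
  have hC0 : 0 < (R * K₁ + K₂)⁻¹ := by positivity
  have hCK : ∀ K, K ≤ R * K₁ + K₂ → (R * K₁ + K₂)⁻¹ * K ≤ 1 := fun K hK => by
    rw [inv_mul_eq_div, div_le_one (by positivity)]
    exact hK
  have hK₁' : K₁ ≤ R * K₁ := le_mul_of_one_le_left hK₁.le hR1
  refine ⟨(R * K₁ + K₂)⁻¹, 6 + 3 * lam + 3 * D, hC0, by positivity, fun n P => ?_⟩
  refine ⟨CahnHilliard.abs_form_le_normTrial P hlam hD, fun U V => ?_,
    CahnHilliard.abs_load_le P, ?_, ?_, ?_,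
    CahnHilliard.test_eq_zero_of_form_eq_zero P hΩ hlam hD hker, fun f => ⟨?_, fun U hU => ?_⟩⟩
  · refine (CahnHilliard.abs_form_le_normGraph P hlam hD U V).trans ?_
    have h3 : 0 ≤ CahnHilliard.normGraph U := Real.sqrt_nonneg _
    have h4 : 0 ≤ CahnHilliard.normTestL2 P V := Real.sqrt_nonneg _
    gcongr <;> linarith
  · refine CahnHilliard.infSup_of_bound P hC0.le (hCK (R * K₁) (by linarith))
      (CahnHilliard.normTestWeighted_nonneg P _)
      (CahnHilliard.form_eq_zero_of_normTestWeighted P hlam hD _) fun U σ hσ hU => ?_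
    refine (h₁ n P U (σ * R) (by positivity) fun V => (hU V).trans ?_).trans_eq (by ring)
    rw [mul_assoc]
    refine mul_le_mul_of_nonneg_left (CahnHilliard.normTest_le P hR1 (fun m => ?_) V) hσ
    exact (Metric.diam_mono (P.le m) hΩ).trans (le_max_right _ _)
  · exact CahnHilliard.infSup_of_bound P hC0.le (hCK K₁ (by linarith))
      (CahnHilliard.normTestWeighted_nonneg P _)
      (CahnHilliard.form_eq_zero_of_normTestWeighted P hlam hD _) (h₁ n P)
  · exact CahnHilliard.infSup_of_bound P hC0.le (hCK K₂ (by nlinarith))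
      (CahnHilliard.normTestWeighted_nonneg P _)
      (CahnHilliard.form_eq_zero_of_normTestWeighted P hlam hD _) (h₂ n P)
  · obtain ⟨U, hU⟩ := CahnHilliard.exists_solution P hΩ hlam hD hker f
    refine ⟨U, hU, fun U' hU' => CahnHilliard.eq_of_normGraph_sub_eq_zero ?_⟩
    refine (h₂ n P _ 0 le_rfl fun V => ?_).trans_eq (mul_zero _)
    rw [CahnHilliard.form_sub, hU' V, hU V, sub_self, abs_zero, zero_mul]
  · have hload : ∀ V, |CahnHilliard.form P lam D U V| ≤ ‖f‖ * CahnHilliard.normTestL2 P V :=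
      fun V => by
        rw [hU V]
        exact CahnHilliard.abs_load_le P f V
    have b₁ := h₁ n P U ‖f‖ (norm_nonneg _) fun V =>
      (hload V).trans (mul_le_mul_of_nonneg_left (CahnHilliard.normTestL2_le P _ V) (norm_nonneg _))
    have b₂ := h₂ n P U ‖f‖ (norm_nonneg _) hload
    have hf := norm_nonneg f
    refine ⟨?_, ?_⟩ <;> rw [inv_mul_le_iff₀ (by positivity)]
    · exact b₁.trans (mul_le_mul_of_nonneg_right (by linarith) hf)
    · exact b₂.trans (mul_le_mul_of_nonneg_right (by nlinarith) hf)
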